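/- Let $g\in C^2(\mathbb R)$ be bounded and strictly increasing, with $g(0)=0$, strictly concave on $(0,+\infty)$ and strictly convex on $(-\infty,0)$, and let $g_\pm=\lim_{s\to\pm\infty}g(s)$. Let $p:\mathbb R\to\mathbb R$ be continuous. There is a constant $H>0$, depending only on $g$ and $p$, such that the following holds for every $T>0$ for which $p$ is $T$-periodic and $$g_-<\frac1T\int_0^T p(t)\,dt<g_+ .$$ For all $k,n\in\mathbb N$ with $k$ odd and $nT\ge H(k+1)$, the equation $$\ddot u+g(u)=p(t)$$ has an $nT$-periodic solution $u\in C^2(\mathbb R)$ which has a zero $t_0$ and exactly $k$ zeros in the open interval $(t_0,t_0+nT)$; equivalently, $u$ has exactly $k+1$ zeros in every half-open interval $[a,a+nT)$. Moreover, if $T$ is the minimal period of $p$ and $n$ and $k+1$ are coprime, then $nT$ is the minimal period of $u$. Consequently there are infinitely many subharmonic solutions: there exist integers $N_1<N_2<\cdots$ and solutions $u_j$ that are $N_jT$-periodic and whose minimal periods $\tau_j$ tend to $+\infty$; if $T$ is the minimal period of $p$, then $\tau_j=N_jT$ for every $j$. -/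

import Mathlib

/-- The standing assumption on the restoring force: `g(0) = 0`, `g` is of class `C²`, bounded,
strictly increasing on `ℝ`, strictly concave on `(0, ∞)` and strictly convex on `(-∞, 0)`. -/
structure IsSaturatingForce (g : ℝ → ℝ) : Prop where
  map_zero : g 0 = 0
  contDiff : ContDiff ℝ 2 g
  bounded : ∃ C : ℝ, ∀ s : ℝ, |g s| ≤ C
  strictMono : StrictMono g
  strictConcaveOn_pos : StrictConcaveOn ℝ (Set.Ioi 0) g
  strictConvexOn_neg : StrictConvexOn ℝ (Set.Iio 0) g

/-- `u` is a classical solution on the whole real line of `u'' + g(u) = p(t)`. -/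
def IsSolution (g p u : ℝ → ℝ) : Prop :=
  ContDiff ℝ 2 u ∧ ∀ t : ℝ, deriv (deriv u) t + g (u t) = p t

/-- `τ` is the minimal (positive) period of `f`. In particular a constant function has none. -/
def IsMinimalPeriod (f : ℝ → ℝ) (τ : ℝ) : Prop :=
  0 < τ ∧ Function.Periodic f τ ∧ ∀ σ : ℝ, 0 < σ → Function.Periodic f σ → τ ≤ σ

/-! The solution is glued from large positive and negative arcs whose end points maximize a total
action (Nehari's method). Let `m` be the mean of `p` and `G` the limit of `g` at `+∞`. On a long
interval a large positive function feels a force close to `G`, while `p` averages to `m < G`; a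
solution vanishing at both ends therefore resembles the parabola `(G - m)/2 · (t - a)(b - t)`. Half
of this parabola is a barrier. `exists_arc` finds a solution above it, and `arc_unique` shows that
there is only one: by concavity the difference quotients of `g` above height `μ` are at most `2 (G -
g (μ/2)) / μ`, and against the Green kernel this is small on average. Negative arcs are positive
arcs of the reflected force `s ↦ -g (-s)`.

The action of an arc is thus a function of its end points. Its partial derivatives are `v(a)²/2` and
`-v(b)²/2` (`hasDerivAt_arcAction_left`, `hasDerivAt_arcAction_right`), and for length `L` it is
`-(G - m)²/24 · L³ + o(L³)` (`arcAction_asymptotics`). Consider partitions of an interval of length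
`nT` into `N = k + 1` pieces of length at least `h`, carrying arcs of alternating sign. Compactness
gives one of maximal total action. A cost of order `-L³` penalizes unequal lengths, so if the
average length is large, no piece of the maximizer has the minimal length `h` (`gap_lt`). Every node
is then a critical point: the velocities of the two adjacent arcs have equal squares there, and both
have the same sign, so the arcs join to a solution. It closes up periodically because `N` is even
(`exists_periodic_solution`), and its zeros are the nodes.

If `T` is the minimal period of `p`, a period of `u` is some `jT`. With `d = gcd(j, n)`, `dT` is a
period too, so `n/d` divides the number `k + 1` of zeros per `nT`; coprimality forces `d = n`. The
infinite family uses `k = 1` and odd `n`. Two zeros per `nT` exclude periods below `nT/3`, so the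
minimal periods tend to infinity even if `T` is not minimal. -/

open Set Filter Topology MeasureTheory
open scoped NNReal Interval

/-! ### Initial value and Dirichlet problems for `u'' = f t u` -/

/-- The first-order vector field of `u'' = f t u`. -/
def phaseField (f : ℝ → ℝ → ℝ) (t : ℝ) (z : ℝ × ℝ) : ℝ × ℝ := (z.2, f t z.1)

lemma lipschitzWith_phaseField {f : ℝ → ℝ → ℝ} {K : ℝ≥0} (hl : ∀ t, LipschitzWith K (f t))
    (t : ℝ) : LipschitzWith (max 1 K) (phaseField f t) := by
  have h1 : LipschitzWith 1 (fun z : ℝ × ℝ => z.2) := LipschitzWith.prod_snd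
  have h2 : LipschitzWith (K * 1) (fun z : ℝ × ℝ => f t z.1) :=
    (hl t).comp LipschitzWith.prod_fst
  rw [mul_one] at h2
  exact h1.prodMk h2

lemma hasDerivAt_fst {α : ℝ → ℝ × ℝ} {z : ℝ × ℝ} {t : ℝ} (h : HasDerivAt α z t) :
    HasDerivAt (fun s => (α s).1) z.1 t :=
  (hasFDerivAt_fst (p := α t)).comp_hasDerivAt t h

lemma hasDerivAt_snd {α : ℝ → ℝ × ℝ} {z : ℝ × ℝ} {t : ℝ} (h : HasDerivAt α z t) :
    HasDerivAt (fun s => (α s).2) z.2 t :=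
  (hasFDerivAt_snd (p := α t)).comp_hasDerivAt t h

/-- Picard–Lindelöf on an interval of prescribed length needs a bounded field, so the velocity is
clamped to `[-R, R]`. Since `|f| ≤ M`, the velocity cannot exceed `R = |z₀.2| + M N` within time
`N`, and the clamp is never active. -/
lemma exists_phase_curve_Ioo {f : ℝ → ℝ → ℝ} {K : ℝ≥0} {M : ℝ} (hc : ∀ x, Continuous fun t => f t x)
    (hl : ∀ t, LipschitzWith K (f t)) (hb : ∀ t x, |f t x| ≤ M) (t₀ : ℝ) (z₀ : ℝ × ℝ)
    {N : ℝ} (hN : 0 < N) :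
    ∃ α : ℝ → ℝ × ℝ, α t₀ = z₀ ∧
      ∀ t ∈ Ioo (t₀ - N) (t₀ + N), HasDerivAt α (phaseField f t (α t)) t := by
  have hM : 0 ≤ M := (abs_nonneg _).trans (hb 0 0)
  set R : ℝ := |z₀.2| + M * N with hR
  have hR0 : 0 ≤ R := by positivity
  set F : ℝ → ℝ × ℝ → ℝ × ℝ := fun t z => (max (-R) (min R z.2), f t z.1) with hF
  have hFl : ∀ t, LipschitzWith (max 1 K) (F t) := by
    intro t
    have h1 : LipschitzWith 1 (fun z : ℝ × ℝ => max (-R) (min R z.2)) :=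
      (LipschitzWith.prod_snd.const_min R).const_max (-R)
    have h2 : LipschitzWith (K * 1) (fun z : ℝ × ℝ => f t z.1) :=
      (hl t).comp LipschitzWith.prod_fst
    rw [mul_one] at h2
    exact h1.prodMk h2
  have hpl : IsPicardLindelof F (tmin := t₀ - N) (tmax := t₀ + N)
      ⟨t₀, by constructor <;> linarith⟩ z₀ ((R + M) * N).toNNReal 0 (R + M).toNNReal
      (max 1 K) := by
    refine ⟨fun t _ => (hFl t).lipschitzOnWith, fun x _ => ?_, fun t _ x _ => ?_, ?_⟩
    · exact (continuous_const.prodMk (hc x.1)).continuousOn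
    · rw [Real.coe_toNNReal _ (by positivity)]
      refine max_le ?_ ?_
      · have : |max (-R) (min R x.2)| ≤ R :=
          abs_le.2 ⟨le_max_left _ _, max_le (by linarith) (min_le_left _ _)⟩
        simp only [hF, Real.norm_eq_abs]; linarith
      · have := hb t x.1
        simp only [hF, Real.norm_eq_abs]; linarith
    · rw [Real.coe_toNNReal _ (by positivity), Real.coe_toNNReal _ (by positivity)]
      simp
  obtain ⟨α, hα0, hα⟩ := hpl.exists_eq_forall_mem_Icc_hasDerivWithinAt₀
  have hα' : ∀ t ∈ Ioo (t₀ - N) (t₀ + N), HasDerivAt α (F t (α t)) t := fun t ht =>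
    (hα t (Ioo_subset_Icc_self ht)).hasDerivAt (Icc_mem_nhds ht.1 ht.2)
  refine ⟨α, hα0, fun t ht => ?_⟩
  have key : |(α t).2| ≤ R := by
    have h := Convex.norm_image_sub_le_of_norm_hasDerivWithin_le (f := fun t => (α t).2)
      (f' := fun t => f t (α t).1) (C := M) (s := Ioo (t₀ - N) (t₀ + N)) (x := t₀) (y := t)
      (fun s hs => (hasDerivAt_snd (hα' s hs)).hasDerivWithinAt) (fun s _ => hb _ _) (convex_Ioo _ _)
      (by constructor <;> linarith) ht
    simp only [Real.norm_eq_abs, hα0] at h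
    have h3 : |t - t₀| ≤ N := abs_le.2 ⟨by linarith [ht.1], by linarith [ht.2]⟩
    have h4 := mul_le_mul_of_nonneg_left h3 hM
    have h5 := abs_sub_abs_le_abs_sub (α t).2 z₀.2
    linarith
  have := hα' t ht
  rw [abs_le] at key
  have e : F t (α t) = phaseField f t (α t) := by
    simp only [hF, phaseField]
    rw [min_eq_right key.2, max_eq_right key.1]
  rwa [e] at this

/-- Global solvability of the initial value problem for `u'' = f t u`, with `f` bounded and
Lipschitz in its second argument. -/
theorem exists_phase_curve {f : ℝ → ℝ → ℝ} {K : ℝ≥0} {M : ℝ} (hc : ∀ x, Continuous fun t => f t x)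
    (hl : ∀ t, LipschitzWith K (f t)) (hb : ∀ t x, |f t x| ≤ M) (t₀ : ℝ) (z₀ : ℝ × ℝ) :
    ∃ α : ℝ → ℝ × ℝ, α t₀ = z₀ ∧ ∀ t, HasDerivAt α (phaseField f t (α t)) t := by
  choose α hα0 hα using fun n : ℕ =>
    exists_phase_curve_Ioo hc hl hb t₀ z₀ (N := (n : ℝ) + 1) (by positivity)
  have agree : ∀ n m : ℕ, n ≤ m → ∀ s ∈ Ioo (t₀ - ((n : ℝ) + 1)) (t₀ + ((n : ℝ) + 1)),
      α n s = α m s := by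
    intro n m hnm s hs
    have hnm' : (n : ℝ) ≤ m := by exact_mod_cast hnm
    refine ODE_solution_unique_of_mem_Ioo (v := phaseField f) (s := fun _ => univ)
      (K := max 1 K) (t₀ := t₀)
      (fun t _ => (lipschitzWith_phaseField hl t).lipschitzOnWith)
      (by constructor <;> linarith [(Nat.cast_nonneg n : (0 : ℝ) ≤ n)])
      (fun t ht => ⟨hα n t ht, mem_univ _⟩)
      (fun t ht => ⟨hα m t ⟨by linarith [ht.1], by linarith [ht.2]⟩, mem_univ _⟩)
      (by rw [hα0, hα0]) hs
  have agree' : ∀ n m : ℕ, ∀ s, |s - t₀| < n + 1 → |s - t₀| < m + 1 → α n s = α m s := by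
    intro n m s h1 h2
    rw [abs_lt] at h1 h2
    rcases le_total n m with h | h
    · exact agree n m h s ⟨by linarith, by linarith⟩
    · exact (agree m n h s ⟨by linarith, by linarith⟩).symm
  -- The curve of index `⌈|t - t₀|⌉₊` lives up to distance one more than its index, hence on a
  -- neighbourhood of `t`.
  refine ⟨fun t => α ⌈|t - t₀|⌉₊ t, hα0 _, fun t => ?_⟩
  set n := ⌈|t - t₀|⌉₊ with hn
  have ht : |t - t₀| < (n : ℝ) + 1 := by linarith [Nat.le_ceil |t - t₀|]
  have h1 := hα n t (by rw [abs_lt] at ht; exact ⟨by linarith, by linarith⟩)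
  refine h1.congr_of_eventuallyEq ?_
  have : ∀ᶠ s in 𝓝 t, |s - t₀| < (n : ℝ) + 1 :=
    (by fun_prop : Continuous fun s : ℝ => |s - t₀|).continuousAt.eventually_lt
      continuousAt_const ht
  filter_upwards [this] with s hs
  exact agree' _ _ s (by linarith [Nat.le_ceil |s - t₀|]) hs

theorem phase_curve_unique {f : ℝ → ℝ → ℝ} {K : ℝ≥0} (hl : ∀ t, LipschitzWith K (f t)) {t₀ : ℝ}
    {α β : ℝ → ℝ × ℝ} (hα : ∀ t, HasDerivAt α (phaseField f t (α t)) t)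
    (hβ : ∀ t, HasDerivAt β (phaseField f t (β t)) t) (h0 : α t₀ = β t₀) : α = β :=
  ODE_solution_unique_univ (v := phaseField f) (s := fun _ => univ) (K := max 1 K)
    (fun t => (lipschitzWith_phaseField hl t).lipschitzOnWith)
    (fun t => ⟨hα t, mem_univ _⟩) (fun t => ⟨hβ t, mem_univ _⟩) h0

theorem phase_curve_unique_Icc {f : ℝ → ℝ → ℝ} {K : ℝ≥0} (hl : ∀ t, LipschitzWith K (f t))
    {a b : ℝ} {α β : ℝ → ℝ × ℝ} (hα : ∀ t ∈ Icc a b, HasDerivAt α (phaseField f t (α t)) t)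
    (hβ : ∀ t ∈ Icc a b, HasDerivAt β (phaseField f t (β t)) t) (h0 : α a = β a) :
    EqOn α β (Icc a b) :=
  ODE_solution_unique (v := phaseField f) (K := max 1 K) (lipschitzWith_phaseField hl)
    (fun t ht => (hα t ht).continuousAt.continuousWithinAt)
    (fun t ht => (hα t (Ico_subset_Icc_self ht)).hasDerivWithinAt)
    (fun t ht => (hβ t ht).continuousAt.continuousWithinAt)
    (fun t ht => (hβ t (Ico_subset_Icc_self ht)).hasDerivWithinAt) h0

theorem phase_curve_dist_le {f : ℝ → ℝ → ℝ} {K : ℝ≥0} (hl : ∀ t, LipschitzWith K (f t))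
    {a : ℝ} {α β : ℝ → ℝ × ℝ} (hα : ∀ t, HasDerivAt α (phaseField f t (α t)) t)
    (hβ : ∀ t, HasDerivAt β (phaseField f t (β t)) t) {t : ℝ} (ht : a ≤ t) :
    dist (α t) (β t) ≤ dist (α a) (β a) * Real.exp ((max 1 K : ℝ≥0) * (t - a)) :=
  dist_le_of_trajectories_ODE (v := phaseField f) (K := max 1 K) (lipschitzWith_phaseField hl)
    (fun t _ => (hα t).continuousAt.continuousWithinAt)
    (fun t _ => (hα t).hasDerivWithinAt)
    (fun t _ => (hβ t).continuousAt.continuousWithinAt)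
    (fun t _ => (hβ t).hasDerivWithinAt) le_rfl t ⟨ht, le_rfl⟩

/-- Solvability of the Dirichlet problem for `u'' = f t u` by shooting. -/
theorem exists_dirichlet {f : ℝ → ℝ → ℝ} {K : ℝ≥0} {M : ℝ} (hc : ∀ x, Continuous fun t => f t x)
    (hl : ∀ t, LipschitzWith K (f t)) (hb : ∀ t x, |f t x| ≤ M) {a b : ℝ} (hab : a < b) :
    ∃ u v : ℝ → ℝ, u a = 0 ∧ u b = 0 ∧ (∀ t, HasDerivAt u (v t) t) ∧
      ∀ t, HasDerivAt v (f t (u t)) t := by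
  have hM : 0 ≤ M := (abs_nonneg _).trans (hb 0 0)
  choose α hα0 hα using fun x : ℝ => exists_phase_curve hc hl hb a (0, x)
  have hcont : Continuous fun x => (α x b).1 := by
    have : LipschitzWith (Real.exp ((max 1 K : ℝ≥0) * (b - a))).toNNReal fun x => (α x b).1 := by
      refine LipschitzWith.of_dist_le_mul fun x y => ?_
      rw [Real.coe_toNNReal _ (Real.exp_pos _).le]
      have h := phase_curve_dist_le hl (hα x) (hα y) hab.le
      rw [hα0, hα0] at h
      have h1 : dist ((0 : ℝ), x) (0, y) = dist x y := by simp [Prod.dist_eq]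
      rw [h1, mul_comm] at h
      exact (le_max_left _ _).trans h
    exact this.continuous
  -- Starting with slope `x`, the height at `b` is `x (b - a)` up to `M (b - a)²`; the slopes `± M
  -- (b - a)` thus end on opposite sides of zero.
  have hest : ∀ x, |(α x b).1 - x * (b - a)| ≤ M * (b - a) * (b - a) := by
    intro x
    have hv : ∀ t ∈ Icc a b, |(α x t).2 - x| ≤ M * (b - a) := by
      intro t ht
      have h := Convex.norm_image_sub_le_of_norm_hasDerivWithin_le (f := fun t => (α x t).2)
        (f' := fun t => f t (α x t).1) (C := M) (s := univ) (x := a) (y := t)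
        (fun s _ => (hasDerivAt_snd (hα x s)).hasDerivWithinAt) (fun s _ => hb _ _) convex_univ
        (mem_univ _) (mem_univ _)
      simp only [Real.norm_eq_abs, hα0] at h
      rw [abs_of_nonneg (by linarith [ht.1] : 0 ≤ t - a)] at h
      exact h.trans (mul_le_mul_of_nonneg_left (by linarith [ht.2]) hM)
    have h := Convex.norm_image_sub_le_of_norm_hasDerivWithin_le
        (f := fun t => (α x t).1 - x * (t - a))
        (f' := fun t => (α x t).2 - x) (C := M * (b - a)) (s := Icc a b) (x := a) (y := b)
        (fun s _ => by
          have h1 := hasDerivAt_fst (hα x s)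
          have h2 : HasDerivAt (fun t => x * (t - a)) x s := by
            simpa using ((hasDerivAt_id s).sub_const a).const_mul x
          exact HasDerivAt.hasDerivWithinAt (HasDerivAt.sub h1 h2))
        (fun s hs => hv s hs) (convex_Icc _ _)
        ⟨le_rfl, hab.le⟩ ⟨hab.le, le_rfl⟩
    simp only [Real.norm_eq_abs, hα0, sub_self, mul_zero, sub_zero] at h
    rwa [abs_of_pos (sub_pos.2 hab)] at h
  set X := M * (b - a) with hX
  have hXn : 0 ≤ X := mul_nonneg hM (by linarith)
  obtain ⟨x, -, hx⟩ : ∃ x ∈ Icc (-X) X, (α x b).1 = 0 := by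
    have hi := intermediate_value_Icc (by linarith : -X ≤ X) hcont.continuousOn
    have h1 := (abs_le.1 (hest X)).1
    have h2 := (abs_le.1 (hest (-X))).2
    exact hi ⟨by linarith, by linarith⟩
  exact ⟨fun t => (α x t).1, fun t => (α x t).2, by simp [hα0], hx,
    fun t => hasDerivAt_fst (hα x t), fun t => hasDerivAt_snd (hα x t)⟩

/-! ### The one-sided force and its deficit along parabolas -/

/-- The hypotheses on force and forcing used for positive arcs: `g` is bounded, Lipschitz, monotone,
concave on the positive axis with limit `G` at `+∞`, and `p` has mean `m` up to a bounded
primitive. -/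
structure PosForce (g p : ℝ → ℝ) (m G M B : ℝ) (K : ℝ≥0) : Prop where
  map_zero : g 0 = 0
  lip : LipschitzWith K g
  bound : ∀ s, |g s| ≤ M
  mono : Monotone g
  lim : Tendsto g atTop (𝓝 G)
  concave : ConcaveOn ℝ (Ioi 0) g
  cont : Continuous p
  bound_p : ∀ t, |p t| ≤ M
  mean : ∀ s t, |(∫ r in s..t, p r) - m * (t - s)| ≤ B
  gap : m < G

/-- The parabola `κ (s - a) (b - s)`. -/
def parab (κ a b s : ℝ) : ℝ := κ * ((s - a) * (b - s))

lemma continuous_parab (κ a b : ℝ) : Continuous (parab κ a b) := by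
  unfold parab; fun_prop

lemma parab_nonneg {κ a b s : ℝ} (hκ : 0 ≤ κ) (hs : s ∈ Icc a b) : 0 ≤ parab κ a b s :=
  mul_nonneg hκ (mul_nonneg (by linarith [hs.1]) (by linarith [hs.2]))

lemma parab_pos {κ a b s : ℝ} (hκ : 0 < κ) (hs : s ∈ Ioo a b) : 0 < parab κ a b s :=
  mul_pos hκ (mul_pos (by linarith [hs.1]) (by linarith [hs.2]))

/-- The total deficit `∫ (G - g)` along half of the parabola of base length `L`. -/
noncomputable def deficit (g : ℝ → ℝ) (G κ L : ℝ) : ℝ :=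
  ∫ s in (0 : ℝ)..L, (G - g (κ / 2 * (s * (L - s))))

/-- Lengths of intervals on which large positive arcs exist and are unique. -/
def LongEnough (g : ℝ → ℝ) (m G B L : ℝ) : Prop :=
  0 < L ∧ 2 * B ≤ (G - m) / 8 * L ∧ deficit g G ((G - m) / 4) L ≤ (G - m) / 16 * L

namespace PosForce

variable {g p : ℝ → ℝ} {m G M B : ℝ} {K : ℝ≥0}

lemma continuous_g (h : PosForce g p m G M B K) : Continuous g := h.lip.continuous

lemma M_nonneg (h : PosForce g p m G M B K) : 0 ≤ M := (abs_nonneg _).trans (h.bound 0)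

lemma B_nonneg (h : PosForce g p m G M B K) : 0 ≤ B := (abs_nonneg _).trans (h.mean 0 0)

lemma le_lim (h : PosForce g p m G M B K) (s : ℝ) : g s ≤ G := h.mono.ge_of_tendsto h.lim s

lemma abs_sub_le (h : PosForce g p m G M B K) (x y : ℝ) : |g x - g y| ≤ K * |x - y| := by
  have := h.lip.dist_le_mul x y
  rwa [Real.dist_eq, Real.dist_eq] at this

lemma lim_le (h : PosForce g p m G M B K) : G ≤ M :=
  le_of_tendsto h.lim (Eventually.of_forall fun s => (le_abs_self _).trans (h.bound s))

lemma neg_le_lim (h : PosForce g p m G M B K) : -M ≤ G :=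
  ge_of_tendsto h.lim (Eventually.of_forall fun s => (abs_le.1 (h.bound s)).1)

lemma lim_nonneg (h : PosForce g p m G M B K) : 0 ≤ G := h.map_zero ▸ h.le_lim 0

lemma comp_neg (h : PosForce g p m G M B K) : PosForce g (fun t => p (-t)) m G M B K where
  map_zero := h.map_zero
  lip := h.lip
  bound := h.bound
  mono := h.mono
  lim := h.lim
  concave := h.concave
  cont := h.cont.comp continuous_neg
  bound_p t := h.bound_p _
  mean s t := by
    rw [intervalIntegral.integral_comp_neg]
    have := h.mean (-t) (-s)
    rwa [show -s - -t = t - s by ring] at this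
  gap := h.gap

/-- Rescaling `s = L x` turns the quotient into the integral over `[0, 1]` of `G - g (κ/2 · L² x (1
- x))`. It tends to zero pointwise for `0 < x < 1` and is dominated by `2 M`. -/
lemma tendsto_deficit_div (h : PosForce g p m G M B K) {κ : ℝ} (hκ : 0 < κ) :
    Tendsto (fun L => deficit g G κ L / L) atTop (𝓝 0) := by
  have e : ∀ᶠ L in atTop,
      ∫ x in (0 : ℝ)..1, (G - g (κ / 2 * ((L * x) * (L - L * x)))) = deficit g G κ L / L := by
    filter_upwards [eventually_gt_atTop 0] with L hL
    have := intervalIntegral.integral_comp_mul_left (a := 0) (b := 1)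
      (fun s => G - g (κ / 2 * (s * (L - s)))) hL.ne'
    rw [this, deficit, mul_zero, mul_one, smul_eq_mul]
    field_simp
  refine Tendsto.congr' e ?_
  suffices H : Tendsto (fun L => ∫ x in (0 : ℝ)..1, (G - g (κ / 2 * ((L * x) * (L - L * x)))))
      atTop (𝓝 (∫ x in (0 : ℝ)..1, (0 : ℝ))) by simpa using H
  refine intervalIntegral.tendsto_integral_filter_of_dominated_convergence (fun _ => 2 * M)
    (Eventually.of_forall fun L => ?_) (Eventually.of_forall fun L => ?_) (intervalIntegrable_const (μ := volume)) ?_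
  · have := h.continuous_g
    exact (by fun_prop : Continuous fun x : ℝ =>
      G - g (κ / 2 * ((L * x) * (L - L * x)))).aestronglyMeasurable
  · refine Eventually.of_forall fun x _ => ?_
    rw [Real.norm_eq_abs, abs_le]
    have h1 := abs_le.1 (h.bound (κ / 2 * ((L * x) * (L - L * x))))
    constructor <;> linarith [h.lim_le, h.neg_le_lim]
  · have hne : ∀ᵐ x : ℝ, x ≠ 1 := by simp [ae_iff, measure_singleton]
    filter_upwards [hne] with x hx1 hx
    rw [uIoc_of_le zero_le_one] at hx
    have hx' : x < 1 := lt_of_le_of_ne hx.2 hx1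
    have h1 : Tendsto (fun L : ℝ => κ / 2 * ((L * x) * (L - L * x))) atTop atTop := by
      have h2 : Tendsto (fun L : ℝ => (κ / 2 * (x * (1 - x))) * L ^ 2) atTop atTop :=
        (tendsto_pow_atTop two_ne_zero).const_mul_atTop
          (mul_pos (by linarith) (mul_pos hx.1 (by linarith)))
      refine h2.congr fun L => by ring
    have h3 := (tendsto_const_nhds (x := G)).sub (h.lim.comp h1)
    simpa using h3

lemma eventually_longEnough (h : PosForce g p m G M B K) :
    ∀ᶠ L in atTop, LongEnough g m G B L := by
  have hA : 0 < G - m := sub_pos.2 h.gap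
  have h1 := (h.tendsto_deficit_div (by linarith : 0 < (G - m) / 4)).eventually_lt_const
    (by linarith : 0 < (G - m) / 16)
  have h2 : ∀ᶠ L in atTop, 2 * B ≤ (G - m) / 8 * L :=
    (tendsto_id.const_mul_atTop (by linarith : 0 < (G - m) / 8)).eventually_ge_atTop _
  filter_upwards [h1, h2, eventually_gt_atTop 0] with L h1 h2 h3
  exact ⟨h3, h2, ((div_lt_iff₀ h3).1 h1).le⟩

lemma integral_deficit_parab (a b κ : ℝ) :
    ∫ s in a..b, (G - g (parab κ a b s / 2)) = deficit g G κ (b - a) := by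
  have := intervalIntegral.integral_comp_sub_right (a := a) (b := b)
    (fun s => G - g (κ / 2 * (s * (b - a - s)))) a
  rw [sub_self] at this
  rw [deficit, ← this]
  congr 1; ext s; unfold parab; congr 2; ring

/-- Increments of `g` above a positive level, by concavity. -/
lemma abs_sub_mul_le (h : PosForce g p m G M B K) {μ x y : ℝ} (hμ : 0 ≤ μ) (hx : μ ≤ x)
    (hy : μ ≤ y) : |g x - g y| * μ ≤ 2 * (G - g (μ / 2)) * |x - y| := by
  wlog hxy : x ≤ y generalizing x y
  · rw [abs_sub_comm (g x), abs_sub_comm x]; exact this hy hx (le_of_not_ge hxy)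
  rcases hμ.eq_or_lt with rfl | hμ
  · simp only [mul_zero]
    exact mul_nonneg (by linarith [h.le_lim (0 / 2)]) (abs_nonneg _)
  rcases hxy.eq_or_lt with rfl | hxy
  · simp
  rw [abs_sub_comm (g x), abs_sub_comm x, abs_of_nonneg (sub_nonneg.2 (h.mono hxy.le)),
    abs_of_pos (sub_pos.2 hxy)]
  -- The comparison slope is taken on `[μ/2, x]` rather than from `0`: its numerator is then at most
  -- the deficit at height `μ/2`, which is small for large `μ`.
  have h1 := h.concave.slope_anti_adjacent (x := μ / 2) (y := x) (z := y)
    (mem_Ioi.2 (by linarith)) (mem_Ioi.2 (by linarith)) (by linarith) hxy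
  have h2 : (g x - g (μ / 2)) / (x - μ / 2) ≤ (G - g (μ / 2)) / (μ / 2) := by
    have : 0 ≤ g x - g (μ / 2) := sub_nonneg.2 (h.mono (by linarith))
    exact div_le_div₀ (by linarith [h.le_lim x]) (by linarith [h.le_lim x]) (by linarith)
      (by linarith)
  have h3 := h1.trans h2
  rw [div_le_div_iff₀ (by linarith) (by linarith)] at h3
  linarith

end PosForce

/-! ### Green's representation and lower bounds for Dirichlet solutions -/

section Green

variable {u v φ : ℝ → ℝ} {a b t : ℝ}

lemma integral_sub_mul_second_deriv (hu : ∀ s, HasDerivAt u (v s) s) (hφ : Continuous φ)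
    (hv : ∀ s ∈ uIcc a t, HasDerivAt v (φ s) s) (c : ℝ) :
    ∫ s in a..t, (s - c) * φ s = ((t - c) * v t - u t) - ((a - c) * v a - u a) := by
  refine intervalIntegral.integral_eq_sub_of_hasDerivAt (f := fun s => (s - c) * v s - u s)
    (fun s hs => ?_) (by apply Continuous.intervalIntegrable; fun_prop)
  have h1 : HasDerivAt (fun s : ℝ => s - c) 1 s := (hasDerivAt_id s).sub_const c
  exact ((h1.mul (hv s hs)).sub (hu s)).congr_deriv (by ring)

/-- Green's representation on `[a, b]`. -/
lemma green_representation (hu : ∀ s, HasDerivAt u (v s) s) (hφ : Continuous φ)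
    (hv : ∀ s ∈ Icc a b, HasDerivAt v (φ s) s) (ht : t ∈ Icc a b) :
    (b - a) * u t = (b - t) * u a + (t - a) * u b
      - (b - t) * (∫ s in a..t, (s - a) * φ s) - (t - a) * ∫ s in t..b, (b - s) * φ s := by
  have h1 := integral_sub_mul_second_deriv (a := a) (t := t) hu hφ
    (fun s hs => hv s (by rw [uIcc_of_le ht.1] at hs; exact ⟨hs.1, hs.2.trans ht.2⟩)) a
  have h2 := integral_sub_mul_second_deriv (a := t) (t := b) hu hφ
    (fun s hs => hv s (by rw [uIcc_of_le ht.2] at hs; exact ⟨ht.1.trans hs.1, hs.2⟩)) b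
  have h3 : ∫ s in t..b, (b - s) * φ s = - ∫ s in t..b, (s - b) * φ s := by
    rw [← intervalIntegral.integral_neg]; congr 1; ext s; ring
  rw [h3, h1, h2]; ring

/-- Both branches of the Green kernel are bounded by `(t - a) (b - t)`. This keeps the estimate
proportional to the parabola, which cancels the factor `1/μ` in the concavity estimate for `g`. -/
lemma abs_green_le (hu : ∀ s, HasDerivAt u (v s) s) (hφ : Continuous φ)
    (hv : ∀ s ∈ Icc a b, HasDerivAt v (φ s) s) (ht : t ∈ Icc a b) (ha : u a = 0) :
    (b - a) * |u t| ≤ (t - a) * |u b| + (t - a) * (b - t) * ∫ s in a..b, |φ s| := by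
  have hta : 0 ≤ t - a := by linarith [ht.1]
  have hbt : 0 ≤ b - t := by linarith [ht.2]
  have h := green_representation hu hφ hv ht
  have i : ∀ x y, IntervalIntegrable (fun s => |φ s|) volume x y := fun x y => by
    apply Continuous.intervalIntegrable; fun_prop
  have h1 : |∫ s in a..t, (s - a) * φ s| ≤ (t - a) * ∫ s in a..t, |φ s| := by
    refine (intervalIntegral.abs_integral_le_integral_abs ht.1).trans ?_
    rw [← intervalIntegral.integral_const_mul]
    refine intervalIntegral.integral_mono_on ht.1
      (by apply Continuous.intervalIntegrable; fun_prop) ((i _ _).const_mul _) fun s hs => ?_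
    rw [abs_mul, abs_of_nonneg (by linarith [hs.1] : 0 ≤ s - a)]
    exact mul_le_mul_of_nonneg_right (by linarith [hs.2]) (abs_nonneg _)
  have h2 : |∫ s in t..b, (b - s) * φ s| ≤ (b - t) * ∫ s in t..b, |φ s| := by
    refine (intervalIntegral.abs_integral_le_integral_abs ht.2).trans ?_
    rw [← intervalIntegral.integral_const_mul]
    refine intervalIntegral.integral_mono_on ht.2
      (by apply Continuous.intervalIntegrable; fun_prop) ((i _ _).const_mul _) fun s hs => ?_
    rw [abs_mul, abs_of_nonneg (by linarith [hs.2] : 0 ≤ b - s)]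
    exact mul_le_mul_of_nonneg_right (by linarith [hs.1]) (abs_nonneg _)
  have h3 := intervalIntegral.integral_add_adjacent_intervals (i a t) (i t b)
  rw [ha, mul_zero, zero_add] at h
  have hL : 0 ≤ b - a := by linarith
  rw [← h3, ← abs_of_nonneg hL, ← abs_mul, h]
  have e1 := mul_le_mul_of_nonneg_left h1 hbt
  have e2 := mul_le_mul_of_nonneg_left h2 hta
  rw [← abs_of_nonneg hbt, ← abs_mul, abs_of_nonneg hbt] at e1
  rw [← abs_of_nonneg hta, ← abs_mul, abs_of_nonneg hta] at e2
  have e3 : |(t - a) * u b| = (t - a) * |u b| := by rw [abs_mul, abs_of_nonneg hta]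
  have t1 := abs_sub ((t - a) * u b - (b - t) * ∫ s in a..t, (s - a) * φ s)
    ((t - a) * ∫ s in t..b, (b - s) * φ s)
  have t2 := abs_sub ((t - a) * u b) ((b - t) * ∫ s in a..t, (s - a) * φ s)
  linarith

end Green

namespace PosForce

variable {g p : ℝ → ℝ} {m G M B : ℝ} {K : ℝ≥0}

/-- Integration by parts against a primitive `F` of `p - m`: the integral equals that of `F t - F
s`, whose integrand is at most `B`. The oscillation of `p` thus contributes linearly in the length,
against the quadratic contribution of `G - m`. -/
lemma integral_sub_mul_le (h : PosForce g p m G M B K) {a t : ℝ} (hat : a ≤ t) :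
    ∫ s in a..t, (s - a) * (p s - m) ≤ B * (t - a) := by
  have hp := h.cont
  set F : ℝ → ℝ := fun s => ∫ r in a..s, (p r - m) with hF
  have hFd : ∀ s, HasDerivAt F (p s - m) s := fun s =>
    (by fun_prop : Continuous fun r => p r - m).integral_hasStrictDerivAt a s |>.hasDerivAt
  have hFc : Continuous F := continuous_iff_continuousAt.2 fun s => (hFd s).continuousAt
  have hFs : ∀ s, F t - F s ≤ B := by
    intro s
    have i : ∀ x y, IntervalIntegrable (fun r => p r - m) volume x y := fun x y => by
      apply Continuous.intervalIntegrable; fun_prop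
    rw [hF]
    simp only
    rw [intervalIntegral.integral_interval_sub_left (i _ _) (i _ _),
      intervalIntegral.integral_sub (hp.intervalIntegrable _ _) (by simp)]
    have := (abs_le.1 (h.mean s t)).2
    simp only [intervalIntegral.integral_const, smul_eq_mul]
    linarith
  have e : ∫ s in a..t, ((s - a) * (p s - m) - (F t - F s)) = 0 := by
    rw [intervalIntegral.integral_eq_sub_of_hasDerivAt (f := fun s => (s - a) * (F s - F t))
      (fun s _ => ?_) (by apply Continuous.intervalIntegrable; fun_prop)]
    · simp
    · have h1 : HasDerivAt (fun s : ℝ => s - a) 1 s := (hasDerivAt_id s).sub_const a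
      exact (h1.mul ((hFd s).sub_const (F t))).congr_deriv (by ring)
  rw [intervalIntegral.integral_sub (by apply Continuous.intervalIntegrable; fun_prop)
    (by apply Continuous.intervalIntegrable; fun_prop)] at e
  have : ∫ s in a..t, (F t - F s) ≤ ∫ s in a..t, B :=
    intervalIntegral.integral_mono_on hat (by apply Continuous.intervalIntegrable; fun_prop)
      (by simp) fun s _ => hFs s
  simp only [intervalIntegral.integral_const, smul_eq_mul] at this
  linarith

lemma integral_sub_mul_force_le (h : PosForce g p m G M B K) {a t : ℝ} (hat : a ≤ t)
    {γ ω : ℝ → ℝ} (hγ : Continuous γ) (hω : Continuous ω) (hω0 : ∀ s, 0 ≤ ω s)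
    (hγω : ∀ s ∈ Icc a t, G - ω s ≤ γ s) :
    ∫ s in a..t, (s - a) * (p s - γ s) ≤
      (t - a) * (B - (G - m) * (t - a) / 2 + ∫ s in a..t, ω s) := by
  have hp := h.cont
  have h1 : ∫ s in a..t, (s - a) * (p s - γ s) ≤
      ∫ s in a..t, ((s - a) * (p s - m) - (G - m) * (s - a) + (t - a) * ω s) := by
    refine intervalIntegral.integral_mono_on hat (by apply Continuous.intervalIntegrable; fun_prop)
      (by apply Continuous.intervalIntegrable; fun_prop) fun s hs => ?_
    have e1 := mul_le_mul_of_nonneg_left (hγω s hs) (by linarith [hs.1] : 0 ≤ s - a)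
    have e2 := mul_le_mul_of_nonneg_right (by linarith [hs.2] : s - a ≤ t - a) (hω0 s)
    linarith
  rw [intervalIntegral.integral_add (by apply Continuous.intervalIntegrable; fun_prop)
    (by apply Continuous.intervalIntegrable; fun_prop),
    intervalIntegral.integral_sub (by apply Continuous.intervalIntegrable; fun_prop)
    (by apply Continuous.intervalIntegrable; fun_prop), intervalIntegral.integral_const_mul,
    intervalIntegral.integral_const_mul] at h1
  have h2 : ∫ s in a..t, (s - a) = (t - a) ^ 2 / 2 := by
    rw [intervalIntegral.integral_comp_sub_right (fun s => s) a, integral_id]; ring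
  rw [h2] at h1
  linarith [h.integral_sub_mul_le hat]

/-- Lower bound for Dirichlet solutions of `u'' = p - γ` when `γ` is close to `G`. -/
lemma dirichlet_lower_bound (h : PosForce g p m G M B K) {a b t : ℝ} (ht : t ∈ Icc a b)
    {u v γ ω : ℝ → ℝ} (hγ : Continuous γ) (hω : Continuous ω) (hω0 : ∀ s, 0 ≤ ω s)
    (hγω : ∀ s ∈ Icc a b, G - ω s ≤ γ s) (hu : ∀ s, HasDerivAt u (v s) s)
    (hv : ∀ s ∈ Icc a b, HasDerivAt v (p s - γ s) s) (ha : u a = 0) (hb : u b = 0) :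
    (t - a) * (b - t) * ((G - m) * (b - a) / 2 - 2 * B - ∫ s in a..b, ω s) ≤ (b - a) * u t := by
  have hp := h.cont
  have hta : 0 ≤ t - a := by linarith [ht.1]
  have hbt : 0 ≤ b - t := by linarith [ht.2]
  have hG := green_representation hu (by fun_prop) hv ht
  rw [ha, hb] at hG
  have h1 := h.integral_sub_mul_force_le ht.1 hγ hω hω0
    (fun s hs => hγω s ⟨hs.1, hs.2.trans ht.2⟩)
  -- The integral over `[t, b]` is the previous estimate after time reversal.
  have h2 := h.comp_neg.integral_sub_mul_force_le (neg_le_neg ht.2)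
    (γ := fun s => γ (-s)) (ω := fun s => ω (-s)) (by fun_prop) (by fun_prop) (fun s => hω0 _)
    (fun s hs => hγω (-s) ⟨by linarith [hs.2, ht.1], by linarith [hs.1]⟩)
  have e1 : ∫ s in (-b)..(-t), (s - -b) * (p (-s) - γ (-s)) =
      ∫ s in t..b, (b - s) * (p s - γ s) := by
    have := intervalIntegral.integral_comp_neg (a := -b) (b := -t)
      (fun s => (b - s) * (p s - γ s))
    rw [neg_neg, neg_neg] at this
    rw [← this]; congr 1; ext s; ring
  have e2 : ∫ s in (-b)..(-t), ω (-s) = ∫ s in t..b, ω s := by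
    rw [intervalIntegral.integral_comp_neg, neg_neg, neg_neg]
  rw [e1, e2] at h2
  have h3 := intervalIntegral.integral_add_adjacent_intervals
    (hω.intervalIntegrable a t) (hω.intervalIntegrable t b) (μ := volume)
  rw [hG, ← h3]
  have f1 := mul_le_mul_of_nonneg_left h1 hbt
  have f2 := mul_le_mul_of_nonneg_left h2 hta
  have e3 : -t - -b = b - t := by ring
  rw [e3] at f2
  linarith

end PosForce

/-! ### Positive arcs: existence, stability, uniqueness -/

/-- A positive arc: a solution `u` of `u'' + g u = p` on `[a, b]`, with `u' = v`, vanishing at the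
end points and lying above the parabola of curvature `κ`. -/
structure IsArc (g p : ℝ → ℝ) (κ a b : ℝ) (u v : ℝ → ℝ) : Prop where
  deriv_fst : ∀ t, HasDerivAt u (v t) t
  cont : Continuous v
  deriv_snd : ∀ t ∈ Icc a b, HasDerivAt v (p t - g (u t)) t
  left : u a = 0
  right : u b = 0
  lower : ∀ t ∈ Icc a b, parab κ a b t ≤ u t

namespace IsArc

variable {g p : ℝ → ℝ} {κ a b : ℝ} {u v : ℝ → ℝ}

lemma continuous_fst (h : IsArc g p κ a b u v) : Continuous u :=
  continuous_iff_continuousAt.2 fun s => (h.deriv_fst s).continuousAt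

lemma nonneg (h : IsArc g p κ a b u v) (hκ : 0 ≤ κ) {t : ℝ} (ht : t ∈ Icc a b) : 0 ≤ u t :=
  (parab_nonneg hκ ht).trans (h.lower t ht)

lemma pos (h : IsArc g p κ a b u v) (hκ : 0 < κ) {t : ℝ} (ht : t ∈ Ioo a b) : 0 < u t :=
  (parab_pos hκ ht).trans_le (h.lower t (Ioo_subset_Icc_self ht))

/-- Time reversal exchanges the two end points, so that facts at the right end yield those at the
left end. -/
lemma comp_neg (h : IsArc g p κ a b u v) :
    IsArc g (fun t => p (-t)) κ (-b) (-a) (fun t => u (-t)) (fun t => -v (-t)) where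
  deriv_fst t := by
    have := (h.deriv_fst (-t)).comp t (hasDerivAt_neg t)
    simpa [Function.comp_def] using this
  cont := (h.cont.comp continuous_neg).neg
  deriv_snd t ht := by
    have := ((h.deriv_snd (-t) ⟨by linarith [ht.2], by linarith [ht.1]⟩).comp t
      (hasDerivAt_neg t)).neg
    simpa [Function.comp_def, Pi.neg_def] using this
  left := by simpa using h.right
  right := by simpa using h.left
  lower t ht := by
    have := h.lower (-t) ⟨by linarith [ht.2], by linarith [ht.1]⟩
    refine le_trans (le_of_eq ?_) this
    unfold parab; ring

lemma translate {τ : ℝ} (h : IsArc g p κ a b u v) (hp : Function.Periodic p τ) :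
    IsArc g p κ (a + τ) (b + τ) (fun t => u (t - τ)) (fun t => v (t - τ)) where
  deriv_fst t := by
    have := (h.deriv_fst (t - τ)).comp_sub_const t τ
    simpa using this
  cont := h.cont.comp (by fun_prop)
  deriv_snd t ht := by
    have := (h.deriv_snd (t - τ) ⟨by linarith [ht.1], by linarith [ht.2]⟩).comp_sub_const t τ
    rwa [hp.sub_eq] at this
  left := by simpa using h.left
  right := by simpa using h.right
  lower t ht := by
    have := h.lower (t - τ) ⟨by linarith [ht.1], by linarith [ht.2]⟩
    refine le_trans (le_of_eq ?_) this
    unfold parab; ring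

end IsArc

namespace PosForce

variable {g p : ℝ → ℝ} {m G M B : ℝ} {K : ℝ≥0} {a b : ℝ} {u v u' v' : ℝ → ℝ}

lemma gap_pos (h : PosForce g p m G M B K) : 0 < G - m := sub_pos.2 h.gap

lemma integral_deficit_le (h : PosForce g p m G M B K) {κ : ℝ} (hκ : 0 ≤ κ) (hab : a ≤ b) :
    ∫ s in a..b, (G - g (parab κ a b s)) ≤ deficit g G κ (b - a) := by
  rw [← integral_deficit_parab]
  have := h.continuous_g
  have := continuous_parab κ a b
  refine intervalIntegral.integral_mono_on hab (by apply Continuous.intervalIntegrable; fun_prop)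
    (by apply Continuous.intervalIntegrable; fun_prop) fun s hs => ?_
  have h1 := parab_nonneg hκ hs
  have := h.mono (by linarith : parab κ a b s / 2 ≤ parab κ a b s)
  linarith

/-- Sharp lower bound for solutions of the Dirichlet problem with truncated nonlinearity. -/
lemma truncated_lower_bound (h : PosForce g p m G M B K) {γ : ℝ → ℝ} (hγ : Continuous γ)
    (hγl : ∀ s ∈ Icc a b, g (parab ((G - m) / 4) a b s) ≤ γ s)
    (hu : ∀ s, HasDerivAt u (v s) s)
    (hv : ∀ s ∈ Icc a b, HasDerivAt v (p s - γ s) s) (ha : u a = 0) (hb : u b = 0)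
    {t : ℝ} (ht : t ∈ Icc a b) :
    (t - a) * (b - t) * ((G - m) * (b - a) / 2 - 2 * B - deficit g G ((G - m) / 4) (b - a))
      ≤ (b - a) * u t := by
  have hA := h.gap_pos
  have hgc := h.continuous_g
  have hpc := continuous_parab ((G - m) / 4) a b
  have h1 := h.dirichlet_lower_bound ht hγ (ω := fun s => G - g (parab ((G - m) / 4) a b s))
    (by fun_prop) (fun s => by linarith [h.le_lim (parab ((G - m) / 4) a b s)])
    (fun s hs => by linarith [hγl s hs]) hu hv ha hb
  refine le_trans (mul_le_mul_of_nonneg_left ?_ (mul_nonneg (by linarith [ht.1])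
    (by linarith [ht.2]))) h1
  linarith [h.integral_deficit_le (by linarith : 0 ≤ (G - m) / 4) (ht.1.trans ht.2)]

/-- The Dirichlet problem is solved with `g (max (parab κ a b t) x)` in place of `g x`. The
truncated force is at least `g` on the parabola whatever the solution does; by
`truncated_lower_bound` this already puts the solution above the parabola, where truncation has no
effect. -/
theorem exists_arc (h : PosForce g p m G M B K) (hL : LongEnough g m G B (b - a)) :
    ∃ u v, IsArc g p ((G - m) / 4) a b u v := by
  have hA := h.gap_pos
  have hab : a < b := by linarith [hL.1]
  have hgc := h.continuous_g
  have hpar := continuous_parab ((G - m) / 4) a b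
  have hp := h.cont
  set κ := (G - m) / 4 with hκ
  obtain ⟨u, v, ha, hb, hu, hv⟩ := exists_dirichlet
    (f := fun t x => p t - g (max (parab κ a b t) x)) (K := K) (M := M + M)
    (fun x => by fun_prop)
    (fun t => by
      have h1 : LipschitzWith (K * 1) (fun x => g (max (parab κ a b t) x)) :=
        h.lip.comp (LipschitzWith.id.const_max _)
      rw [mul_one] at h1
      have h2 := (LipschitzWith.const (p t)).sub h1
      simpa using h2)
    (fun t x => (abs_sub _ _).trans (add_le_add (h.bound_p _) (h.bound _))) hab
  have huc : Continuous u := continuous_iff_continuousAt.2 fun s => (hu s).continuousAt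
  have hlow : ∀ t ∈ Icc a b, parab κ a b t ≤ u t := by
    intro t ht
    have h1 := h.truncated_lower_bound (γ := fun s => g (max (parab κ a b s) (u s)))
      (by fun_prop) (fun s _ => h.mono (le_max_left _ _)) hu (fun s _ => hv s) ha hb ht
    have h2 : (b - a) * parab κ a b t ≤ (b - a) * u t := by
      refine le_trans ?_ h1
      have h3 : 0 ≤ (t - a) * (b - t) := mul_nonneg (by linarith [ht.1]) (by linarith [ht.2])
      have h4 : (b - a) * parab κ a b t = (t - a) * (b - t) * ((b - a) * κ) := by
        unfold parab; ring
      rw [h4, hκ]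
      refine mul_le_mul_of_nonneg_left ?_ h3
      have h5 := mul_pos hA hL.1
      -- `LongEnough` leaves the factor `1/2 - 1/8 - 1/16 = 5/16` of `(G - m) (b - a)`, which
      -- exceeds the `1/4` in `κ`.
      linarith [hL.2.1, hL.2.2]
    exact le_of_mul_le_mul_left h2 hL.1
  refine ⟨u, v, hu, continuous_iff_continuousAt.2 fun s => (hv s).continuousAt, ?_, ha, hb, hlow⟩
  intro t ht
  have := hv t
  rwa [max_eq_right (hlow t ht)] at this

lemma arc_lower_bound (h : PosForce g p m G M B K) (hu : IsArc g p ((G - m) / 4) a b u v)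
    {t : ℝ} (ht : t ∈ Icc a b) :
    (t - a) * (b - t) * ((G - m) * (b - a) / 2 - 2 * B - deficit g G ((G - m) / 4) (b - a))
      ≤ (b - a) * u t :=
  h.truncated_lower_bound (h.continuous_g.comp hu.continuous_fst)
    (fun s hs => h.mono (hu.lower s hs)) hu.deriv_fst hu.deriv_snd hu.left hu.right ht

/-- Two solutions above the parabola that agree at `a` differ at most by a multiple of their
difference at `b`. -/
theorem solution_perturbation (h : PosForce g p m G M B K) (hL : LongEnough g m G B (b - a))
    (hu : ∀ t, HasDerivAt u (v t) t) (hv : ∀ t ∈ Icc a b, HasDerivAt v (p t - g (u t)) t)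
    (hul : ∀ t ∈ Icc a b, parab ((G - m) / 4) a b t ≤ u t)
    (hu' : ∀ t, HasDerivAt u' (v' t) t) (hv' : ∀ t ∈ Icc a b, HasDerivAt v' (p t - g (u' t)) t)
    (hul' : ∀ t ∈ Icc a b, parab ((G - m) / 4) a b t ≤ u' t) (ha : u' a = u a) :
    (∀ t ∈ Icc a b, |u' t - u t| ≤ (1 + 2 * K * (b - a) ^ 2) * |u' b - u b|) ∧
      (b - a) * |v' b - v b| ≤ (1 + 2 * K * (b - a) ^ 2) * |u' b - u b| := by
  have hA := h.gap_pos
  have hab : a < b := by linarith [hL.1]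
  have hgc := h.continuous_g
  have huc : Continuous u := continuous_iff_continuousAt.2 fun s => (hu s).continuousAt
  have huc' : Continuous u' := continuous_iff_continuousAt.2 fun s => (hu' s).continuousAt
  have hpar := continuous_parab ((G - m) / 4) a b
  set κ := (G - m) / 4 with hκ
  set φ : ℝ → ℝ := fun s => g (u s) - g (u' s) with hφ
  have hφc : Continuous φ := by fun_prop
  set X := |u' b - u b| with hX
  set Φ := ∫ s in a..b, |φ s| with hΦ
  have hw : ∀ s, HasDerivAt (fun t => u' t - u t) (v' s - v s) s := fun s => (hu' s).sub (hu s)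
  have hw' : ∀ s ∈ Icc a b, HasDerivAt (fun t => v' t - v t) (φ s) s := fun s hs =>
    ((hv' s hs).sub (hv s hs)).congr_deriv (by simp only [hφ]; ring)
  have hΦ0 : 0 ≤ Φ := intervalIntegral.integral_nonneg hab.le fun _ _ => abs_nonneg _
  have hX0 : 0 ≤ X := abs_nonneg _
  have hK0 : (0 : ℝ) ≤ K := K.2
  have hwb : ∀ s ∈ Icc a b, |u' s - u s| ≤ X + (s - a) * (b - s) * (Φ / (b - a)) := by
    intro s hs
    have h1 := abs_green_le hw hφc hw' hs (by simp [ha])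
    have h2 : (s - a) * X ≤ (b - a) * X := mul_le_mul_of_nonneg_right (by linarith [hs.2]) hX0
    have h3 : (b - a) * |u' s - u s| ≤ (b - a) * (X + (s - a) * (b - s) * (Φ / (b - a))) := by
      have : (b - a) * (X + (s - a) * (b - s) * (Φ / (b - a))) =
        (b - a) * X + (s - a) * (b - s) * Φ := by field_simp [hL.1.ne']
      rw [this]; linarith
    exact le_of_mul_le_mul_left h3 hL.1
  -- Multiply `|φ|` by `|u' - u| ≤ X + parab · Z`, where `Z = Φ / ((b - a) κ)`. The term with `X` is
  -- estimated by the Lipschitz constant, the term with `parab` by concavity; both then contain `|u'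
  -- - u|`, which is divided out.
  have hφb : ∀ s ∈ Icc a b,
      |φ s| ≤ K * X + 2 * (G - g (parab κ a b s / 2)) * (Φ / ((b - a) * κ)) := by
    intro s hs
    have hμ := parab_nonneg (by linarith : 0 ≤ κ) hs
    have h1 := h.abs_sub_mul_le hμ (hul s hs) (hul' s hs)
    have h2 := h.abs_sub_le (u s) (u' s)
    have h3 := hwb s hs
    have h4 : (s - a) * (b - s) * (Φ / (b - a)) = parab κ a b s * (Φ / ((b - a) * κ)) := by
      have : κ ≠ 0 := by rw [hκ]; linarith
      have := hL.1.ne'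
      unfold parab; field_simp
    rw [h4, abs_sub_comm] at h3
    have hZ : 0 ≤ Φ / ((b - a) * κ) := div_nonneg hΦ0 (mul_nonneg hL.1.le (by linarith))
    have hω : 0 ≤ G - g (parab κ a b s / 2) := by linarith [h.le_lim (parab κ a b s / 2)]
    change |g (u s) - g (u' s)| ≤ _
    rcases (abs_nonneg (u s - u' s)).eq_or_lt with h0 | h0
    · rw [← h0, mul_zero] at h2
      refine h2.trans (by positivity)
    · refine le_of_mul_le_mul_right ?_ h0
      have f1 := mul_le_mul_of_nonneg_left h3 (abs_nonneg (g (u s) - g (u' s)))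
      have f2 := mul_le_mul_of_nonneg_right h2 hX0
      have f3 := mul_le_mul_of_nonneg_right h1 hZ
      linarith
  have hint : Φ ≤ K * X * (b - a) + 2 * deficit g G κ (b - a) * (Φ / ((b - a) * κ)) := by
    have h1 := intervalIntegral.integral_mono_on (μ := volume) hab.le
      (by apply Continuous.intervalIntegrable; fun_prop)
      (by apply Continuous.intervalIntegrable; fun_prop) hφb
    rw [intervalIntegral.integral_add (by apply Continuous.intervalIntegrable; fun_prop)
      (by apply Continuous.intervalIntegrable; fun_prop), intervalIntegral.integral_const,
      smul_eq_mul, intervalIntegral.integral_mul_const,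
      intervalIntegral.integral_const_mul, integral_deficit_parab] at h1
    linarith
  -- The deficit is at most `κ/4 · (b - a)`, so this term is absorbed into the left side.
  have hhalf : 2 * deficit g G κ (b - a) * (Φ / ((b - a) * κ)) ≤ Φ / 2 := by
    have hκ0 : 0 < κ := by linarith
    rw [mul_div_assoc', div_le_iff₀ (mul_pos hL.1 hκ0)]
    have := mul_le_mul_of_nonneg_right hL.2.2 hΦ0
    have e : (G - m) / 16 = κ / 4 := by rw [hκ]; ring
    rw [e] at this
    linarith
  have hfin : Φ ≤ 2 * K * (b - a) * X := by linarith
  refine ⟨fun t ht => (hwb t ht).trans ?_, ?_⟩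
  · have h1 : (t - a) * (b - t) ≤ (b - a) * (b - a) :=
      mul_le_mul (by linarith [ht.2]) (by linarith [ht.1]) (by linarith [ht.2]) hL.1.le
    have h2 := mul_le_mul_of_nonneg_right h1 (div_nonneg hΦ0 hL.1.le)
    have h3 : (b - a) * (b - a) * (Φ / (b - a)) = (b - a) * Φ := by
      have := hL.1.ne'
      field_simp
    have h4 := mul_le_mul_of_nonneg_left hfin hL.1.le
    rw [h3] at h2
    linarith
  · have h1 := integral_sub_mul_second_deriv (a := a) (t := b) hw hφc
      (fun s hs => hw' s (by rwa [uIcc_of_le hab.le] at hs)) a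
    have h2 : |∫ s in a..b, (s - a) * φ s| ≤ (b - a) * Φ := by
      refine (intervalIntegral.abs_integral_le_integral_abs hab.le).trans ?_
      rw [hΦ, ← intervalIntegral.integral_const_mul]
      refine intervalIntegral.integral_mono_on hab.le
        (by apply Continuous.intervalIntegrable; fun_prop)
        (by apply Continuous.intervalIntegrable; fun_prop) fun s hs => ?_
      rw [abs_mul, abs_of_nonneg (by linarith [hs.1] : 0 ≤ s - a)]
      exact mul_le_mul_of_nonneg_right (by linarith [hs.2]) (abs_nonneg _)
    simp only [ha, sub_self, zero_mul, sub_zero] at h1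
    have h3 : (b - a) * (v' b - v b) = (∫ s in a..b, (s - a) * φ s) + (u' b - u b) := by
      rw [h1]; ring
    have h4 : (b - a) * |v' b - v b| = |(b - a) * (v' b - v b)| := by
      rw [abs_mul, abs_of_pos hL.1]
    rw [h4, h3]
    have h5 := mul_le_mul_of_nonneg_left hfin hL.1.le
    refine (abs_add_le _ _).trans ?_
    linarith

theorem arc_unique (h : PosForce g p m G M B K) (hL : LongEnough g m G B (b - a))
    (hu : IsArc g p ((G - m) / 4) a b u v) (hu' : IsArc g p ((G - m) / 4) a b u' v') :
    EqOn u' u (Icc a b) := by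
  have h1 := (h.solution_perturbation hL hu.deriv_fst hu.deriv_snd hu.lower hu'.deriv_fst
    hu'.deriv_snd hu'.lower (by rw [hu.left, hu'.left])).1
  intro t ht
  have h2 := h1 t ht
  rw [hu.right, hu'.right, sub_self, abs_zero, mul_zero] at h2
  exact sub_eq_zero.1 (abs_nonpos_iff.1 h2)

end PosForce

/-! ### The action of an arc and its first variation -/

/-- The primitive of `g` vanishing at `0`. -/
noncomputable def prim (g : ℝ → ℝ) (x : ℝ) : ℝ := ∫ y in (0 : ℝ)..x, g y

/-- The action of `u'' + g u = p` on `[a, b]`. -/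
noncomputable def action (g p : ℝ → ℝ) (a b : ℝ) (u v : ℝ → ℝ) : ℝ :=
  ∫ t in a..b, (v t ^ 2 / 2 - prim g (u t) + p t * u t)

open Classical in
/-- The action of the positive arc on `[a, b]`, as a function of the end points. -/
noncomputable def arcAction (g p : ℝ → ℝ) (κ a b : ℝ) : ℝ :=
  if h : ∃ z : (ℝ → ℝ) × (ℝ → ℝ), IsArc g p κ a b z.1 z.2 then
    action g p a b h.choose.1 h.choose.2 else 0

lemma IsArc.action_comp_neg {g p : ℝ → ℝ} {a b : ℝ} {u v : ℝ → ℝ} :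
    action g (fun t => p (-t)) (-b) (-a) (fun t => u (-t)) (fun t => -v (-t)) =
      action g p a b u v := by
  unfold action
  have := intervalIntegral.integral_comp_neg (a := -b) (b := -a)
    (fun t => v t ^ 2 / 2 - prim g (u t) + p t * u t)
  rw [neg_neg, neg_neg] at this
  rw [← this]
  simp only [neg_sq]

lemma IsArc.action_translate {g p : ℝ → ℝ} {a b τ : ℝ} {u v : ℝ → ℝ}
    (hp : Function.Periodic p τ) :
    action g p (a + τ) (b + τ) (fun t => u (t - τ)) (fun t => v (t - τ)) =
      action g p a b u v := by
  unfold action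
  have := intervalIntegral.integral_comp_sub_right (a := a + τ) (b := b + τ)
    (fun t => v t ^ 2 / 2 - prim g (u t) + p t * u t) τ
  simp only [add_sub_cancel_right, hp.sub_eq] at this
  exact this

namespace PosForce

variable {g p : ℝ → ℝ} {m G M B : ℝ} {K : ℝ≥0} {a b : ℝ} {u v u' v' : ℝ → ℝ}

lemma hasDerivAt_prim (h : PosForce g p m G M B K) (x : ℝ) : HasDerivAt (prim g) (g x) x :=
  (h.continuous_g.integral_hasStrictDerivAt 0 x).hasDerivAt

lemma continuous_prim (h : PosForce g p m G M B K) : Continuous (prim g) :=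
  continuous_iff_continuousAt.2 fun x => (h.hasDerivAt_prim x).continuousAt

lemma abs_prim_le (h : PosForce g p m G M B K) (x : ℝ) : |prim g x| ≤ M * |x| := by
  have := intervalIntegral.norm_integral_le_of_norm_le_const (a := 0) (b := x) (f := g) (C := M)
    fun y _ => h.bound y
  simpa [prim] using this

/-- The functions are free outside `[a, b]`, so equality of the derivatives is obtained in the open
interval and carried to the end points by continuity. -/
lemma arc_unique_snd (h : PosForce g p m G M B K) (hL : LongEnough g m G B (b - a))
    (hu : IsArc g p ((G - m) / 4) a b u v) (hu' : IsArc g p ((G - m) / 4) a b u' v') :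
    EqOn v' v (Icc a b) := by
  have hab : a < b := by linarith [hL.1]
  have h0 := h.arc_unique hL hu hu'
  have h1 : EqOn v' v (Ioo a b) := by
    intro t ht
    have h2 : u' =ᶠ[𝓝 t] u := by
      filter_upwards [Ioo_mem_nhds ht.1 ht.2] with s hs using h0 (Ioo_subset_Icc_self hs)
    exact (hu'.deriv_fst t).unique ((hu.deriv_fst t).congr_of_eventuallyEq h2)
  have := h1.closure hu'.cont hu.cont
  rwa [closure_Ioo hab.ne] at this

/-- By uniqueness the arc chosen in `arcAction` is immaterial, and on long intervals the default
value `0` does not occur. -/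
lemma arcAction_eq (h : PosForce g p m G M B K) (hL : LongEnough g m G B (b - a))
    (hu : IsArc g p ((G - m) / 4) a b u v) :
    arcAction g p ((G - m) / 4) a b = action g p a b u v := by
  have hab : a < b := by linarith [hL.1]
  have hex : ∃ z : (ℝ → ℝ) × (ℝ → ℝ), IsArc g p ((G - m) / 4) a b z.1 z.2 := ⟨(u, v), hu⟩
  rw [arcAction, dif_pos hex]
  have h1 := h.arc_unique hL hu hex.choose_spec
  have h2 := h.arc_unique_snd hL hu hex.choose_spec
  refine intervalIntegral.integral_congr fun t ht => ?_
  rw [uIcc_of_le hab.le] at ht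
  simp only [h1 ht, h2 ht]

lemma arcAction_comp_neg (h : PosForce g p m G M B K) (hL : LongEnough g m G B (b - a)) :
    arcAction g (fun t => p (-t)) ((G - m) / 4) (-b) (-a) = arcAction g p ((G - m) / 4) a b := by
  obtain ⟨u, v, hu⟩ := h.exists_arc hL
  rw [h.arcAction_eq hL hu, h.comp_neg.arcAction_eq
    (by rwa [show -a - -b = b - a by ring]) hu.comp_neg, IsArc.action_comp_neg]

lemma arcAction_translate (h : PosForce g p m G M B K) (hL : LongEnough g m G B (b - a)) {τ : ℝ}
    (hp : Function.Periodic p τ) :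
    arcAction g p ((G - m) / 4) (a + τ) (b + τ) = arcAction g p ((G - m) / 4) a b := by
  obtain ⟨u, v, hu⟩ := h.exists_arc hL
  rw [h.arcAction_eq hL hu, h.arcAction_eq
    (by rwa [show b + τ - (a + τ) = b - a by ring]) (hu.translate hp), IsArc.action_translate hp]

/-- The trapezoidal rule for `prim g`: the error is quadratic in the increment, so it contributes
only at second order to the variation of the action. -/
lemma abs_trapezoid_le (h : PosForce g p m G M B K) (x y : ℝ) :
    |(g x + g y) / 2 * (y - x) - (prim g y - prim g x)| ≤ K * (y - x) ^ 2 := by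
  have hc := h.continuous_g
  have e : (g x + g y) / 2 * (y - x) - (prim g y - prim g x) =
      ∫ z in x..y, ((g x + g y) / 2 - g z) := by
    rw [intervalIntegral.integral_sub (by simp) (hc.intervalIntegrable _ _), prim, prim,
      intervalIntegral.integral_interval_sub_left (hc.intervalIntegrable _ _)
        (hc.intervalIntegrable _ _), intervalIntegral.integral_const, smul_eq_mul]
    ring
  rw [e, ← Real.norm_eq_abs]
  have := intervalIntegral.norm_integral_le_of_norm_le_const (a := x) (b := y)
    (f := fun z => (g x + g y) / 2 - g z) (C := K * |y - x|) fun z hz => ?_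
  · rwa [mul_assoc, ← abs_mul, ← sq, abs_of_nonneg (sq_nonneg (y - x))] at this
  · have hz' : z ∈ uIcc x y := uIoc_subset_uIcc hz
    have hz1 : |x - z| ≤ |y - x| := by
      rw [abs_sub_comm]; exact abs_sub_left_of_mem_uIcc hz'
    have hz2 : |y - z| ≤ |y - x| := abs_sub_right_of_mem_uIcc hz'
    have h1 := (h.abs_sub_le x z).trans (mul_le_mul_of_nonneg_left hz1 K.coe_nonneg)
    have h2 := (h.abs_sub_le y z).trans (mul_le_mul_of_nonneg_left hz2 K.coe_nonneg)
    rw [abs_le] at h1 h2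
    rw [Real.norm_eq_abs, abs_le]
    constructor <;> linarith

/-- The difference of the actions of two solutions. -/
lemma action_sub_action (h : PosForce g p m G M B K) (hab : a ≤ b)
    (hu : ∀ t, HasDerivAt u (v t) t) (hvc : Continuous v)
    (hv : ∀ t ∈ Icc a b, HasDerivAt v (p t - g (u t)) t)
    (hu' : ∀ t, HasDerivAt u' (v' t) t) (hvc' : Continuous v')
    (hv' : ∀ t ∈ Icc a b, HasDerivAt v' (p t - g (u' t)) t) :
    action g p a b u' v' - action g p a b u v =
      ((v b + v' b) / 2 * (u' b - u b) - (v a + v' a) / 2 * (u' a - u a)) +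
      ∫ t in a..b, ((g (u t) + g (u' t)) / 2 * (u' t - u t) - (prim g (u' t) - prim g (u t))) := by
  have hgc := h.continuous_g
  have hp := h.cont
  have hpr := h.continuous_prim
  have huc : Continuous u := continuous_iff_continuousAt.2 fun s => (hu s).continuousAt
  have huc' : Continuous u' := continuous_iff_continuousAt.2 fun s => (hu' s).continuousAt
  have e := intervalIntegral.integral_eq_sub_of_hasDerivAt (a := a) (b := b)
    -- The averaged velocity makes the kinetic part of the derivative exactly `(v'² - v²)/2`; what
    -- remains is the trapezoidal error of `prim g`.
    (f := fun t => (v t + v' t) / 2 * (u' t - u t))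
    (f' := fun t => ((p t - g (u t)) + (p t - g (u' t))) / 2 * (u' t - u t) +
      (v t + v' t) / 2 * (v' t - v t))
    (fun t ht => by
      rw [uIcc_of_le hab] at ht
      exact (((hv t ht).add (hv' t ht)).div_const 2).mul ((hu' t).sub (hu t)))
    (by apply Continuous.intervalIntegrable; fun_prop)
  rw [← e, action, action, ← intervalIntegral.integral_sub
    (by apply Continuous.intervalIntegrable; fun_prop)
    (by apply Continuous.intervalIntegrable; fun_prop), ← intervalIntegral.integral_add
    (by apply Continuous.intervalIntegrable; fun_prop)
    (by apply Continuous.intervalIntegrable; fun_prop)]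
  congr 1; ext t; ring

lemma abs_sub_snd_le (h : PosForce g p m G M B K) (hu : IsArc g p ((G - m) / 4) a b u v)
    {s t : ℝ} (hs : s ∈ Icc a b) (ht : t ∈ Icc a b) : |v t - v s| ≤ 2 * M * |t - s| := by
  have := Convex.norm_image_sub_le_of_norm_hasDerivWithin_le (f := v)
    (f' := fun t => p t - g (u t)) (C := 2 * M) (s := Icc a b) (x := s) (y := t)
    (fun s hs => (hu.deriv_snd s hs).hasDerivWithinAt)
    (fun s _ => by
      rw [Real.norm_eq_abs]
      have := (abs_sub (p s) (g (u s))).trans (add_le_add (h.bound_p s) (h.bound _))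
      linarith) (convex_Icc _ _) hs ht
  simpa using this

lemma abs_snd_le (h : PosForce g p m G M B K) (hab : a < b)
    (hu : IsArc g p ((G - m) / 4) a b u v) {t : ℝ} (ht : t ∈ Icc a b) :
    |v t| ≤ 2 * M * (b - a) := by
  obtain ⟨s, hs, hs0⟩ := exists_hasDerivAt_eq_zero hab hu.continuous_fst.continuousOn
    (by rw [hu.left, hu.right]) (fun s _ => hu.deriv_fst s)
  have h1 := h.abs_sub_snd_le hu (Ioo_subset_Icc_self hs) ht
  rw [hs0, sub_zero] at h1
  refine h1.trans (mul_le_mul_of_nonneg_left ?_ (by linarith [h.M_nonneg]))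
  rw [abs_le]; constructor <;> linarith [ht.1, ht.2, hs.1, hs.2]

lemma abs_sub_fst_le (h : PosForce g p m G M B K) (hab : a < b)
    (hu : IsArc g p ((G - m) / 4) a b u v) {s t : ℝ} (hs : s ∈ Icc a b) (ht : t ∈ Icc a b) :
    |u t - u s| ≤ 2 * M * (b - a) * |t - s| := by
  have := Convex.norm_image_sub_le_of_norm_hasDerivWithin_le (f := u)
    (f' := v) (C := 2 * M * (b - a)) (s := Icc a b) (x := s) (y := t)
    (fun s _ => (hu.deriv_fst s).hasDerivWithinAt)
    (fun s hs => h.abs_snd_le hab hu hs) (convex_Icc _ _) hs ht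
  simpa using this

/-- First variation of the arc action in the right end point, with a quantitative remainder. -/
theorem action_variation (h : PosForce g p m G M B K) (Λ : ℝ) :
    ∃ C : ℝ, 0 ≤ C ∧ ∀ a b b' u v u' v', LongEnough g m G B (b - a) → 1 ≤ b - a → b ≤ b' →
      b' - a ≤ Λ → IsArc g p ((G - m) / 4) a b u v → IsArc g p ((G - m) / 4) a b' u' v' →
      |action g p a b' u' v' - action g p a b u v + v b ^ 2 / 2 * (b' - b)| ≤ C * (b' - b) ^ 2 ∧
        |v' b' - v b| ≤ C * (b' - b) := by
  have hM := h.M_nonneg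
  have hgc := h.continuous_g
  have hp := h.cont
  have hpr := h.continuous_prim
  have hK : (0 : ℝ) ≤ K := K.2
  set C₁ := 2 * M * |Λ| with hC₁
  set C₂ := 1 + 2 * K * |Λ| ^ 2 with hC₂
  have hC₁0 : 0 ≤ C₁ := by positivity
  have hC₂0 : 0 ≤ C₂ := by positivity
  -- `C₁` bounds the velocities and `C₂` is the factor of `solution_perturbation`. The summands come
  -- from `hlead`, `hEb` and `htail`; the last bracket serves the velocity estimate.
  refine ⟨2 * M * C₁ + C₁ * (C₂ * C₁) / 2 + K * |Λ| * (C₂ * C₁) ^ 2 + 2 * M * C₁ + 2 * M * C₁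
    + (2 * M + C₂ * C₁), by positivity, ?_⟩
  intro a b b' u v u' v' hL hL1 hbb' hΛ hu hu'
  have hab : a < b := by linarith
  have hab' : a < b' := by linarith
  set δ := b' - b with hδ
  have hδ0 : 0 ≤ δ := by linarith
  have hΛ' : b' - a ≤ |Λ| := hΛ.trans (le_abs_self _)
  have hbI : b ∈ Icc a b' := ⟨hab.le, hbb'⟩
  have hbI' : b' ∈ Icc a b' := ⟨hab'.le, le_rfl⟩
  have hv'1 : ∀ t ∈ Icc a b', |v' t| ≤ C₁ := fun t ht =>
    (h.abs_snd_le hab' hu' ht).trans (mul_le_mul_of_nonneg_left hΛ' (by linarith))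
  have hv1 : |v b| ≤ C₁ := (h.abs_snd_le hab hu ⟨hab.le, le_rfl⟩).trans
    (mul_le_mul_of_nonneg_left (by linarith) (by linarith))
  have hu'1 : ∀ t ∈ Icc b b', |u' t| ≤ C₁ * δ := by
    intro t ht
    have h1 := h.abs_sub_fst_le hab' hu' hbI' (t := t) ⟨hab.le.trans ht.1, ht.2⟩
    rw [hu'.right, sub_zero] at h1
    refine h1.trans (mul_le_mul (mul_le_mul_of_nonneg_left hΛ' (by linarith)) ?_ (abs_nonneg _)
      hC₁0)
    rw [abs_le]; constructor <;> linarith [ht.1, ht.2]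
  -- The parabola over the longer interval dominates that over `[a, b]`, so `u'` may be compared
  -- with `u` there although `u' b` need not vanish.
  have hpar : ∀ t ∈ Icc a b, parab ((G - m) / 4) a b t ≤ u' t := by
    intro t ht
    refine le_trans ?_ (hu'.lower t ⟨ht.1, ht.2.trans hbb'⟩)
    unfold parab
    refine mul_le_mul_of_nonneg_left (mul_le_mul_of_nonneg_left (by linarith)
      (by linarith [ht.1])) (by linarith [h.gap_pos])
  have hv'd : ∀ t ∈ Icc a b, HasDerivAt v' (p t - g (u' t)) t := fun t ht =>
    hu'.deriv_snd t ⟨ht.1, ht.2.trans hbb'⟩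
  obtain ⟨hw, hwv⟩ := h.solution_perturbation hL hu.deriv_fst hu.deriv_snd hu.lower
    hu'.deriv_fst hv'd hpar (by rw [hu.left, hu'.left])
  have hub : |u' b - u b| ≤ C₁ * δ := by
    rw [hu.right, sub_zero]; exact hu'1 b ⟨le_rfl, hbb'⟩
  have hC₂' : 1 + 2 * K * (b - a) ^ 2 ≤ C₂ := by
    have : (b - a) ^ 2 ≤ |Λ| ^ 2 := pow_le_pow_left₀ (by linarith) (by linarith) 2
    have := mul_le_mul_of_nonneg_left this (by positivity : 0 ≤ 2 * (K : ℝ))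
    linarith
  have hC₃ : (1 + 2 * K * (b - a) ^ 2) * |u' b - u b| ≤ C₂ * (C₁ * δ) :=
    mul_le_mul hC₂' hub (abs_nonneg _) hC₂0
  have hw1 : ∀ t ∈ Icc a b, |u' t - u t| ≤ C₂ * (C₁ * δ) := fun t ht => (hw t ht).trans hC₃
  have hwv1 : |v' b - v b| ≤ C₂ * (C₁ * δ) := by
    refine le_trans ?_ (hwv.trans hC₃)
    exact le_mul_of_one_le_left (abs_nonneg _) hL1
  have hvv : ∀ t ∈ Icc b b', |v' t - v' b| ≤ 2 * M * δ := fun t ht =>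
    (h.abs_sub_snd_le hu' hbI ⟨hab.le.trans ht.1, ht.2⟩).trans
      (mul_le_mul_of_nonneg_left (by rw [abs_of_nonneg (by linarith [ht.1])]; linarith [ht.2])
        (by linarith))
  have huc := hu.continuous_fst
  have huc' := hu'.continuous_fst
  have hvc := hu.cont
  have hvc' := hu'.cont
  have hsplit : action g p a b' u' v' = action g p a b u' v' + action g p b b' u' v' := by
    unfold action
    rw [intervalIntegral.integral_add_adjacent_intervals] <;>
    (apply Continuous.intervalIntegrable; fun_prop)
  have hdiff := h.action_sub_action hab.le hu.deriv_fst hvc hu.deriv_snd hu'.deriv_fst hvc' hv'd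
  rw [hu.left, hu'.left, hu.right, sub_self, mul_zero, sub_zero, sub_zero] at hdiff
  set E := ∫ t in a..b, ((g (u t) + g (u' t)) / 2 * (u' t - u t) -
    (prim g (u' t) - prim g (u t))) with hE
  have hEb : |E| ≤ K * |Λ| * (C₂ * C₁) ^ 2 * δ ^ 2 := by
    have := intervalIntegral.norm_integral_le_of_norm_le_const (a := a) (b := b)
      (f := fun t => (g (u t) + g (u' t)) / 2 * (u' t - u t) - (prim g (u' t) - prim g (u t)))
      (C := K * (C₂ * (C₁ * δ)) ^ 2) fun t ht => by
        rw [uIoc_of_le hab.le] at ht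
        refine (h.abs_trapezoid_le _ _).trans (mul_le_mul_of_nonneg_left ?_ hK)
        rw [← sq_abs]
        exact pow_le_pow_left₀ (abs_nonneg _) (hw1 t (Ioc_subset_Icc_self ht)) 2
    rw [Real.norm_eq_abs] at this
    refine this.trans ?_
    have h2 : K * (C₂ * (C₁ * δ)) ^ 2 * |b - a| ≤ K * (C₂ * (C₁ * δ)) ^ 2 * |Λ| :=
      mul_le_mul_of_nonneg_left (by rw [abs_of_pos (by linarith)]; linarith) (by positivity)
    refine h2.trans (le_of_eq (by ring))
  have hub2 : |u' b + v' b * δ| ≤ 2 * M * δ * δ := by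
    have := intervalIntegral.norm_integral_le_of_norm_le_const (a := b) (b := b')
      (f := fun t => v' t - v' b) (C := 2 * M * δ) fun t ht => by
        rw [uIoc_of_le hbb'] at ht
        exact hvv t (Ioc_subset_Icc_self ht)
    rw [intervalIntegral.integral_sub (hvc'.intervalIntegrable _ _) (by simp),
      intervalIntegral.integral_eq_sub_of_hasDerivAt (fun t _ => hu'.deriv_fst t)
        (hvc'.intervalIntegrable _ _), hu'.right, intervalIntegral.integral_const, smul_eq_mul,
      ← hδ, abs_of_nonneg hδ0, Real.norm_eq_abs, ← abs_neg] at this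
    refine le_trans (le_of_eq ?_) this
    congr 1; ring
  have htail : |action g p b b' u' v' - v' b ^ 2 / 2 * δ| ≤
      (2 * M * C₁ + 2 * M * C₁) * δ * δ := by
    have e : action g p b b' u' v' - v' b ^ 2 / 2 * δ =
        ∫ t in b..b', (v' t ^ 2 / 2 - prim g (u' t) + p t * u' t - v' b ^ 2 / 2) := by
      rw [intervalIntegral.integral_sub (by apply Continuous.intervalIntegrable; fun_prop)
        (by simp), intervalIntegral.integral_const, smul_eq_mul, action]
      ring
    have := intervalIntegral.norm_integral_le_of_norm_le_const (a := b) (b := b')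
      (f := fun t => v' t ^ 2 / 2 - prim g (u' t) + p t * u' t - v' b ^ 2 / 2)
      (C := (2 * M * C₁ + 2 * M * C₁) * δ) fun t ht => by
        rw [uIoc_of_le hbb'] at ht
        have ht' := Ioc_subset_Icc_self ht
        have htI : t ∈ Icc a b' := ⟨hab.le.trans ht'.1, ht'.2⟩
        have f1 : |v' t ^ 2 / 2 - v' b ^ 2 / 2| ≤ 2 * M * δ * C₁ := by
          have : v' t ^ 2 / 2 - v' b ^ 2 / 2 = (v' t - v' b) * ((v' t + v' b) / 2) := by ring
          rw [this, abs_mul]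
          refine mul_le_mul (hvv t ht') ?_ (abs_nonneg _) (by positivity)
          have q1 := abs_le.1 (hv'1 t htI)
          have q2 := abs_le.1 (hv'1 b hbI)
          rw [abs_le]; constructor <;> linarith
        have f2 : |prim g (u' t)| ≤ M * (C₁ * δ) :=
          (h.abs_prim_le _).trans (mul_le_mul_of_nonneg_left (hu'1 t ht') hM)
        have f3 : |p t * u' t| ≤ M * (C₁ * δ) := by
          rw [abs_mul]; exact mul_le_mul (h.bound_p t) (hu'1 t ht') (abs_nonneg _) hM
        rw [Real.norm_eq_abs]
        rw [abs_le] at f1 f2 f3 ⊢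
        constructor <;> linarith
    rw [e, ← Real.norm_eq_abs]
    rwa [← hδ, abs_of_nonneg hδ0] at this
  -- Since `u' b = -v' b · δ + O(δ²)`, the first-order part collapses to `-v b (v' b - v b)/2 · δ`,
  -- which is of second order.
  have hlead : |(v b + v' b) / 2 * u' b + v' b ^ 2 / 2 * δ + v b ^ 2 / 2 * δ| ≤
      2 * M * C₁ * δ ^ 2 + C₁ * (C₂ * C₁) / 2 * δ ^ 2 := by
    have e : (v b + v' b) / 2 * u' b + v' b ^ 2 / 2 * δ + v b ^ 2 / 2 * δ =
      (v b + v' b) / 2 * (u' b + v' b * δ) - v b * (v' b - v b) / 2 * δ := by ring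
    rw [e]
    have q1 : |(v b + v' b) / 2| ≤ C₁ := by
      have q1 := abs_le.1 hv1
      have q2 := abs_le.1 (hv'1 b hbI)
      rw [abs_le]; constructor <;> linarith
    have q2 : |(v b + v' b) / 2 * (u' b + v' b * δ)| ≤ C₁ * (2 * M * δ * δ) := by
      rw [abs_mul]; exact mul_le_mul q1 hub2 (abs_nonneg _) hC₁0
    have q3 : |v b * (v' b - v b) / 2 * δ| ≤ C₁ * (C₂ * (C₁ * δ)) / 2 * δ := by
      rw [abs_mul, abs_div, abs_mul, abs_of_nonneg hδ0, abs_two]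
      have := mul_le_mul hv1 hwv1 (abs_nonneg _) hC₁0
      exact mul_le_mul_of_nonneg_right (by linarith) hδ0
    refine (abs_sub _ _).trans ((add_le_add q2 q3).trans (le_of_eq (by ring)))
  constructor
  · have e : action g p a b' u' v' - action g p a b u v + v b ^ 2 / 2 * δ =
        ((v b + v' b) / 2 * u' b + v' b ^ 2 / 2 * δ + v b ^ 2 / 2 * δ) + E +
          (action g p b b' u' v' - v' b ^ 2 / 2 * δ) := by rw [hsplit]; linarith
    rw [e]
    refine (abs_add_three _ _ _).trans ((add_le_add (add_le_add hlead hEb) htail).trans ?_)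
    have : 0 ≤ (2 * M + C₂ * C₁) * δ ^ 2 := by positivity
    linarith
  · have h1 := hvv b' ⟨hbb', le_rfl⟩
    have h2 := _root_.abs_sub_le (v' b') (v' b) (v b)
    have : 0 ≤ (2 * M * C₁ + C₁ * (C₂ * C₁) / 2 + K * |Λ| * (C₂ * C₁) ^ 2 + 2 * M * C₁
      + 2 * M * C₁) * δ := by positivity
    linarith

end PosForce

/-! ### Regularity and cubic asymptotics of the arc action -/

namespace PosForce

variable {g p : ℝ → ℝ} {m G M B : ℝ} {K : ℝ≥0} {a b h₀ : ℝ} {u v : ℝ → ℝ}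

/-- For `s ≥ b` this is `action_variation`. For `s < b` the roles are exchanged, which gives the
velocity at `s` instead of `b`; the velocity estimate makes the discrepancy quadratic. -/
theorem hasDerivAt_arcAction_right (h : PosForce g p m G M B K)
    (hh : ∀ L, h₀ ≤ L → LongEnough g m G B L) (h1 : 1 ≤ h₀) (hab : h₀ < b - a)
    (hu : IsArc g p ((G - m) / 4) a b u v) :
    HasDerivAt (fun s => arcAction g p ((G - m) / 4) a s) (-(v b ^ 2 / 2)) b := by
  obtain ⟨C, hC0, hC⟩ := h.action_variation (b - a + 1)
  have hM := h.M_nonneg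
  set C₁ := 2 * M * (b - a + 1) with hC₁
  have hC₁0 : 0 ≤ C₁ := mul_nonneg (by linarith) (by linarith)
  have key : ∀ᶠ s in 𝓝 b, |arcAction g p ((G - m) / 4) a s - arcAction g p ((G - m) / 4) a b -
      (s - b) * -(v b ^ 2 / 2)| ≤ (C + C₁ * C) * |s - b| ^ 2 := by
    filter_upwards [Ioo_mem_nhds (show b - min 1 (b - a - h₀) < b by
      linarith [lt_min one_pos (by linarith : 0 < b - a - h₀)]) (show b < b + 1 by linarith)]
      with s hs
    have hs1 : h₀ ≤ s - a := by linarith [hs.1, min_le_right 1 (b - a - h₀)]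
    have hs2 : b - 1 < s := by linarith [hs.1, min_le_left 1 (b - a - h₀)]
    obtain ⟨w, z, hw⟩ := h.exists_arc (hh _ hs1)
    rw [h.arcAction_eq (hh _ hs1) hw, h.arcAction_eq (hh _ hab.le) hu]
    rcases le_total b s with hbs | hbs
    · have := (hC a b s u v w z (hh _ hab.le) (by linarith) hbs (by linarith [hs.2]) hu hw).1
      rw [sq_abs]
      have e : action g p a s w z - action g p a b u v - (s - b) * -(v b ^ 2 / 2) =
        action g p a s w z - action g p a b u v + v b ^ 2 / 2 * (s - b) := by ring
      rw [e]
      refine this.trans ?_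
      have : 0 ≤ C₁ * C * (s - b) ^ 2 := by positivity
      linarith
    · have h2 := hC a s b w z u v (hh _ hs1) (by linarith) hbs (by linarith) hw hu
      have q1 : |z s| ≤ C₁ := (h.abs_snd_le (by linarith) hw ⟨by linarith, le_rfl⟩).trans
        (mul_le_mul_of_nonneg_left (by linarith) (by linarith))
      have q2 : |v b| ≤ C₁ := (h.abs_snd_le (by linarith) hu ⟨by linarith, le_rfl⟩).trans
        (mul_le_mul_of_nonneg_left (by linarith) (by linarith))
      have e : action g p a s w z - action g p a b u v - (s - b) * -(v b ^ 2 / 2) =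
        -(action g p a b u v - action g p a s w z + z s ^ 2 / 2 * (b - s)) -
          (v b - z s) * ((v b + z s) / 2) * (b - s) := by ring
      rw [e, sq_abs]
      refine (abs_sub _ _).trans ?_
      rw [abs_neg, abs_mul, abs_mul, abs_of_nonneg (by linarith : 0 ≤ b - s)]
      have q3 : |(v b + z s) / 2| ≤ C₁ := by
        rw [abs_le] at q1 q2 ⊢; constructor <;> linarith
      have q4 := mul_le_mul h2.2 q3 (abs_nonneg _) (mul_nonneg hC0 (by linarith))
      have q5 := mul_le_mul_of_nonneg_right q4 (by linarith : 0 ≤ b - s)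
      have q6 := h2.1
      have e2 : (C + C₁ * C) * (s - b) ^ 2 =
        C * (b - s) ^ 2 + C * (b - s) * C₁ * (b - s) := by ring
      rw [e2]
      exact add_le_add q6 q5
  rw [hasDerivAt_iff_isLittleO]
  refine (Asymptotics.IsBigO.of_bound (g := fun s : ℝ => ‖s - b‖ ^ 2) (C + C₁ * C) ?_).trans_isLittleO
    (Asymptotics.isLittleO_pow_sub_sub b one_lt_two)
  filter_upwards [key] with s hs
  simpa using hs

theorem hasDerivAt_arcAction_left (h : PosForce g p m G M B K)
    (hh : ∀ L, h₀ ≤ L → LongEnough g m G B L) (h1 : 1 ≤ h₀) (hab : h₀ < b - a)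
    (hu : IsArc g p ((G - m) / 4) a b u v) :
    HasDerivAt (fun s => arcAction g p ((G - m) / 4) s b) (v a ^ 2 / 2) a := by
  have h2 := h.comp_neg.hasDerivAt_arcAction_right hh h1
    (by linarith : h₀ < -a - -b) hu.comp_neg
  have h3 := h2.comp a (hasDerivAt_neg a)
  simp only [neg_neg, neg_sq, mul_neg, mul_one] at h3
  refine h3.congr_of_eventuallyEq ?_
  have : ∀ᶠ s in 𝓝 a, s < b - h₀ := eventually_lt_nhds (by linarith)
  filter_upwards [this] with s hs
  exact (h.arcAction_comp_neg (hh _ (by linarith))).symm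

/-- The action is Lipschitz in the right end point, uniformly for left end points near `a`, because
its derivative is bounded by the squared speed. Continuity in the left end point alone at fixed `b`
then suffices. -/
theorem continuousAt_arcAction (h : PosForce g p m G M B K)
    (hh : ∀ L, h₀ ≤ L → LongEnough g m G B L) (h1 : 1 ≤ h₀) (hab : h₀ < b - a) :
    ContinuousAt (fun z : ℝ × ℝ => arcAction g p ((G - m) / 4) z.1 z.2) (a, b) := by
  have hM := h.M_nonneg
  set κ := (G - m) / 4 with hκ
  set r := min 1 ((b - a - h₀) / 4) with hr
  have hr0 : 0 < r := lt_min one_pos (by linarith)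
  have hr1 : r ≤ 1 := min_le_left _ _
  have hr2 : r ≤ (b - a - h₀) / 4 := min_le_right _ _
  set C := (2 * M * (b - a + 2)) ^ 2 / 2 with hC
  have hlip : ∀ a' ∈ Ioo (a - r) (a + r), ∀ b' ∈ Ioo (b - r) (b + r),
      |arcAction g p κ a' b' - arcAction g p κ a' b| ≤ C * |b' - b| := by
    intro a' ha' b' hb'
    have hlong : ∀ s ∈ Ioo (b - r) (b + r), h₀ < s - a' := fun s hs => by
      linarith [ha'.2, hs.1]
    choose! w z hw using fun s (hs : s ∈ Ioo (b - r) (b + r)) => h.exists_arc (hh _ (hlong s hs).le)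
    have := Convex.norm_image_sub_le_of_norm_hasDerivWithin_le
      (f := fun s => arcAction g p κ a' s)
      (f' := fun s => -(z s s ^ 2 / 2)) (C := C) (s := Ioo (b - r) (b + r)) (x := b) (y := b')
      (fun s hs => (h.hasDerivAt_arcAction_right hh h1 (hlong s hs) (hw s hs)).hasDerivWithinAt)
      (fun s hs => ?_) (convex_Ioo _ _) ⟨by linarith, by linarith⟩ hb'
    · simpa using this
    · have hpos := hlong s hs
      have q := h.abs_snd_le (by linarith) (hw s hs) (t := s) ⟨by linarith, le_rfl⟩
      have q2 : |z s s| ≤ 2 * M * (b - a + 2) := q.trans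
        (mul_le_mul_of_nonneg_left (by linarith [ha'.1, hs.2]) (by linarith))
      rw [norm_neg, Real.norm_eq_abs, abs_div, abs_two, abs_pow]
      exact div_le_div_of_nonneg_right (pow_le_pow_left₀ (abs_nonneg _) q2 2) two_pos.le
  obtain ⟨w, z, hw⟩ := h.exists_arc (hh _ hab.le)
  have hleft := (h.hasDerivAt_arcAction_left hh h1 hab hw).continuousAt
  have e1 : Tendsto (fun z : ℝ × ℝ => arcAction g p κ z.1 b) (𝓝 (a, b))
      (𝓝 (arcAction g p κ a b)) := hleft.tendsto.comp continuous_fst.continuousAt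
  have e2 : Tendsto (fun z : ℝ × ℝ => arcAction g p κ z.1 z.2 - arcAction g p κ z.1 b) (𝓝 (a, b))
      (𝓝 0) := by
    have hb0 : Tendsto (fun z : ℝ × ℝ => C * |z.2 - b|) (𝓝 (a, b)) (𝓝 0) := by
      have : Continuous fun z : ℝ × ℝ => C * |z.2 - b| := by fun_prop
      simpa using this.tendsto (a, b)
    refine squeeze_zero_norm' ?_ hb0
    have hn : Ioo (a - r) (a + r) ×ˢ Ioo (b - r) (b + r) ∈ 𝓝 (a, b) :=
      prod_mem_nhds (Ioo_mem_nhds (by linarith) (by linarith))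
        (Ioo_mem_nhds (by linarith) (by linarith))
    filter_upwards [hn] with z hz
    exact hlip _ hz.1 _ hz.2
  have := e2.add e1
  simpa [ContinuousAt] using this

lemma prim_le (h : PosForce g p m G M B K) {x : ℝ} (hx : 0 ≤ x) : prim g x ≤ G * x := by
  have := intervalIntegral.integral_mono_on (μ := volume) hx
    (h.continuous_g.intervalIntegrable 0 x) (intervalIntegrable_const (c := G))
    fun y _ => h.le_lim y
  simp only [intervalIntegral.integral_const, smul_eq_mul] at this
  unfold prim; linarith

lemma exists_le_prim (h : PosForce g p m G M B K) {η : ℝ} (hη : 0 < η) :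
    ∃ C : ℝ, ∀ x, 0 ≤ x → (G - η) * x - C ≤ prim g x := by
  obtain ⟨R, hR0, hR⟩ : ∃ R : ℝ, 0 ≤ R ∧ ∀ x, R ≤ x → G - η ≤ g x := by
    have := (h.lim.eventually_const_le (by linarith : G - η < G)).and (eventually_ge_atTop 0)
    obtain ⟨R, hR⟩ := eventually_atTop.1 this
    exact ⟨max R 0, le_max_right _ _, fun x hx => (hR x ((le_max_left _ _).trans hx)).1⟩
  have hg0 : ∀ y, 0 ≤ y → 0 ≤ g y := fun y hy => h.map_zero ▸ h.mono hy
  have hi : ∀ x y, IntervalIntegrable g volume x y := h.continuous_g.intervalIntegrable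
  have hprim0 : ∀ x, 0 ≤ x → 0 ≤ prim g x := fun x hx =>
    intervalIntegral.integral_nonneg hx fun y hy => hg0 y hy.1
  have hG := h.lim_nonneg
  refine ⟨G * R, fun x hx => ?_⟩
  rcases le_total x R with hxR | hxR
  · have h1 := hprim0 x hx
    have h2 := mul_le_mul_of_nonneg_left hxR hG
    have h3 := mul_nonneg hη.le hx
    linarith
  · have h1 := intervalIntegral.integral_add_adjacent_intervals (hi 0 R) (hi R x)
    have h2 := intervalIntegral.integral_mono_on (μ := volume) hxR
      (intervalIntegrable_const (c := G - η)) (hi R x) fun y hy => hR y hy.1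
    simp only [intervalIntegral.integral_const, smul_eq_mul] at h2
    have h3 := hprim0 R hR0
    have h4 := mul_nonneg hη.le hR0
    unfold prim at h3 ⊢
    linarith

/-- The primitive of the oscillating part of `p`. -/
lemma exists_primitive (h : PosForce g p m G M B K) (a : ℝ) :
    ∃ F : ℝ → ℝ, (∀ s, HasDerivAt F (p s - m) s) ∧ ∀ s, |F s| ≤ B := by
  have hp := h.cont
  refine ⟨fun s => ∫ r in a..s, (p r - m), fun s =>
    (by fun_prop : Continuous fun r => p r - m).integral_hasStrictDerivAt a s |>.hasDerivAt,
    fun s => ?_⟩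
  beta_reduce
  rw [intervalIntegral.integral_sub (hp.intervalIntegrable _ _) (by simp),
    intervalIntegral.integral_const, smul_eq_mul, mul_comm]
  exact h.mean a s

/-- From `prim g u ≤ G u` the integrand is at least `v²/2 + (p - G) u`. Integrating by parts against
the primitive `w = F - (G - m) (t - c)` of `p - G` and completing the square leaves `-w²/2`; with
`c` the midpoint, its leading part integrates to `-(G - m)²/24 · (b - a)³`. -/
lemma action_ge (h : PosForce g p m G M B K) (hab : a < b)
    (hu : IsArc g p ((G - m) / 4) a b u v) :
    -((G - m) ^ 2 / 24 * (b - a) ^ 3) - (G - m) * B * (b - a) ^ 2 - B ^ 2 / 2 * (b - a)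
      ≤ action g p a b u v := by
  have hA := h.gap_pos
  have hB := h.B_nonneg
  have hp := h.cont
  have hpr := h.continuous_prim
  have huc := hu.continuous_fst
  have hvc := hu.cont
  obtain ⟨F, hF, hFb⟩ := h.exists_primitive a
  have hFc : Continuous F := continuous_iff_continuousAt.2 fun s => (hF s).continuousAt
  set c := (a + b) / 2 with hc
  have e := intervalIntegral.integral_eq_sub_of_hasDerivAt (a := a) (b := b)
    (f := fun t => (F t - (G - m) * (t - c)) * u t)
    (f' := fun t => (p t - m - (G - m)) * u t + (F t - (G - m) * (t - c)) * v t)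
    (fun t _ => by
      have h1 : HasDerivAt (fun t : ℝ => (G - m) * (t - c)) (G - m) t := by
        simpa using ((hasDerivAt_id t).sub_const c).const_mul (G - m)
      exact ((hF t).sub h1).mul (hu.deriv_fst t))
    (by apply Continuous.intervalIntegrable; fun_prop)
  rw [hu.left, hu.right, mul_zero, mul_zero, sub_zero] at e
  have h1 : ∫ t in a..b, (((p t - m - (G - m)) * u t + (F t - (G - m) * (t - c)) * v t) -
      ((G - m) ^ 2 / 2 * (t - c) ^ 2 + ((G - m) * B * (b - a) + B ^ 2 / 2))) ≤
      action g p a b u v := by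
    refine intervalIntegral.integral_mono_on hab.le
      (by apply Continuous.intervalIntegrable; fun_prop)
      (by apply Continuous.intervalIntegrable; fun_prop) fun t ht => ?_
    have f1 := h.prim_le (hu.nonneg (by linarith) ht)
    have f2 : 0 ≤ (v t - (F t - (G - m) * (t - c))) ^ 2 := sq_nonneg _
    have f3 : (F t) ^ 2 ≤ B ^ 2 := sq_le_sq' (abs_le.1 (hFb t)).1 (abs_le.1 (hFb t)).2
    have f4 : -(F t * (t - c)) ≤ B * (b - a) := by
      refine (neg_le_abs _).trans ?_
      rw [abs_mul]
      refine mul_le_mul (hFb t) ?_ (abs_nonneg _) hB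
      rw [abs_le]; constructor <;> linarith [ht.1, ht.2]
    have f5 := mul_le_mul_of_nonneg_left f4 hA.le
    linarith
  rw [intervalIntegral.integral_sub (by apply Continuous.intervalIntegrable; fun_prop)
    (by apply Continuous.intervalIntegrable; fun_prop), e,
    intervalIntegral.integral_add (by apply Continuous.intervalIntegrable; fun_prop) (by simp),
    intervalIntegral.integral_const_mul, intervalIntegral.integral_const, smul_eq_mul,
    intervalIntegral.integral_comp_sub_right (fun t => t ^ 2) c, integral_pow] at h1
  refine le_trans (le_of_eq ?_) h1
  rw [hc]; push_cast; ring

/-- Multiplying the equation by `u` removes the kinetic energy. What remains is at most `-(G - m)/2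
· u` up to lower-order terms and a small multiple of `u`, and `arc_lower_bound` for `u` produces the
same cubic coefficient as in `action_ge`. -/
lemma action_le (h : PosForce g p m G M B K) (hab : a < b) {η C : ℝ} (hη : 0 ≤ η)
    (hC : ∀ x, 0 ≤ x → (G - η) * x - C ≤ prim g x)
    (hu : IsArc g p ((G - m) / 4) a b u v) :
    action g p a b u v ≤ -((G - m) ^ 2 / 24 * (b - a) ^ 3) + B * M * (b - a) ^ 2 +
      (G - m) / 12 * (2 * B + deficit g G ((G - m) / 4) (b - a)) * (b - a) ^ 2 +
      2 * η * M * (b - a) ^ 3 + C * (b - a) := by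
  have hA := h.gap_pos
  have hB := h.B_nonneg
  have hM := h.M_nonneg
  have hp := h.cont
  have hgc := h.continuous_g
  have hpr := h.continuous_prim
  have huc := hu.continuous_fst
  have hvc := hu.cont
  obtain ⟨F, hF, hFb⟩ := h.exists_primitive a
  have hFc : Continuous F := continuous_iff_continuousAt.2 fun s => (hF s).continuousAt
  have hL : 0 < b - a := sub_pos.2 hab
  set D := deficit g G ((G - m) / 4) (b - a) with hD
  have e := intervalIntegral.integral_eq_sub_of_hasDerivAt (a := a) (b := b)
    (f := fun t => u t * v t / 2 + F t * u t / 2)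
    (f' := fun t => (v t * v t + u t * (p t - g (u t))) / 2 + ((p t - m) * u t + F t * v t) / 2)
    (fun t ht => by
      rw [uIcc_of_le hab.le] at ht
      exact (((hu.deriv_fst t).mul (hu.deriv_snd t ht)).div_const 2).add
        (((hF t).mul (hu.deriv_fst t)).div_const 2))
    (by apply Continuous.intervalIntegrable; fun_prop)
  rw [hu.left, hu.right] at e
  simp only [zero_mul, mul_zero, zero_div, add_zero, sub_zero] at e
  set S := (G - m) / 2 * (((G - m) * (b - a) / 2 - 2 * B - D) / (b - a)) with hS
  have h1 : action g p a b u v ≤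
      ∫ t in a..b, (((v t * v t + u t * (p t - g (u t))) / 2 +
        ((p t - m) * u t + F t * v t) / 2) +
      ((B * M * (b - a) + 2 * η * M * (b - a) ^ 2 + C) - S * ((t - a) * (b - t)))) := by
    refine intervalIntegral.integral_mono_on hab.le
      (by apply Continuous.intervalIntegrable; fun_prop)
      (by apply Continuous.intervalIntegrable; fun_prop) fun t ht => ?_
    have hu0 := hu.nonneg (by linarith) ht
    have f1 := hC (u t) hu0
    have f2 := mul_le_mul_of_nonneg_left (h.le_lim (u t)) hu0
    have f3 : -(F t * v t) ≤ B * (2 * M * (b - a)) := by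
      refine (neg_le_abs _).trans ?_
      rw [abs_mul]
      exact mul_le_mul (hFb t) (h.abs_snd_le hab hu ht) (abs_nonneg _) hB
    have f4 : u t ≤ 2 * M * (b - a) * (b - a) := by
      have q := h.abs_sub_fst_le hab hu (s := a) ⟨le_rfl, hab.le⟩ ht
      rw [hu.left, sub_zero, abs_of_nonneg hu0, abs_of_nonneg (by linarith [ht.1])] at q
      exact q.trans (mul_le_mul_of_nonneg_left (by linarith [ht.2]) (by positivity))
    have f5 := mul_le_mul_of_nonneg_left f4 hη
    have f6 : S * ((t - a) * (b - t)) ≤ (G - m) / 2 * u t := by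
      have q := h.arc_lower_bound hu ht
      rw [← hD] at q
      rw [hS, mul_assoc]
      refine mul_le_mul_of_nonneg_left ?_ (by linarith)
      rw [div_mul_eq_mul_div, div_le_iff₀ hL]
      linarith
    linarith
  have h2 : ∫ t in a..b, ((t - a) * (b - t)) = (b - a) ^ 3 / 6 := by
    rw [intervalIntegral.integral_eq_sub_of_hasDerivAt
      (f := fun t => (b - a) * (t - a) ^ 2 / 2 - (t - a) ^ 3 / 3) (fun t _ => ?_)
      (by apply Continuous.intervalIntegrable; fun_prop)]
    · ring
    · have q : HasDerivAt (fun t : ℝ => t - a) 1 t := (hasDerivAt_id t).sub_const a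
      exact ((((q.pow 2).const_mul (b - a)).div_const 2).sub ((q.pow 3).div_const 3)).congr_deriv
        (by push_cast; ring)
  rw [intervalIntegral.integral_add (by apply Continuous.intervalIntegrable; fun_prop)
    (by apply Continuous.intervalIntegrable; fun_prop), e,
    intervalIntegral.integral_sub (by simp) (by apply Continuous.intervalIntegrable; fun_prop),
    intervalIntegral.integral_const_mul, intervalIntegral.integral_const, smul_eq_mul, h2] at h1
  refine h1.trans (le_of_eq ?_)
  rw [hS]
  have := hL.ne'
  field_simp
  ring

/-- Cubic asymptotics of the arc action. -/
theorem arcAction_asymptotics (h : PosForce g p m G M B K) {ε : ℝ} (hε : 0 < ε) :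
    ∀ᶠ L in atTop, ∀ a b, b - a = L →
      |arcAction g p ((G - m) / 4) a b + (G - m) ^ 2 / 24 * L ^ 3| ≤ ε * L ^ 3 := by
  have hA := h.gap_pos
  have hM := h.M_nonneg
  set η := ε / (4 * (M + 1)) with hη
  have hη0 : 0 < η := by positivity
  have hηM : 2 * η * M ≤ ε / 2 := by
    have : 2 * η * M = ε / 2 * (M / (M + 1)) := by rw [hη]; field_simp; ring
    rw [this]
    refine mul_le_of_le_one_right (by positivity) ?_
    rw [div_le_one (by positivity)]; linarith
  obtain ⟨C, hC⟩ := h.exists_le_prim hη0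
  have hi : Tendsto (fun L : ℝ => L⁻¹) atTop (𝓝 0) := tendsto_inv_atTop_zero
  have hd := h.tendsto_deficit_div (by linarith : 0 < (G - m) / 4)
  have t1 : Tendsto (fun L : ℝ => B * M * L⁻¹ + (G - m) / 12 * (2 * B * L⁻¹ +
      deficit g G ((G - m) / 4) L / L) + C * (L⁻¹ * L⁻¹)) atTop (𝓝 0) := by
    have := ((hi.const_mul (B * M)).add (((hi.const_mul (2 * B)).add hd).const_mul
      ((G - m) / 12))).add ((hi.mul hi).const_mul C)
    simpa using this
  have t2 : Tendsto (fun L : ℝ => (G - m) * B * L⁻¹ + B ^ 2 / 2 * (L⁻¹ * L⁻¹)) atTop (𝓝 0) := by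
    have := (hi.const_mul ((G - m) * B)).add ((hi.mul hi).const_mul (B ^ 2 / 2))
    simpa using this
  filter_upwards [h.eventually_longEnough, t1.eventually_le_const (half_pos hε),
    t2.eventually_le_const hε, eventually_gt_atTop 0] with L hL hL1 hL2 hL0 a b hab
  have hlt : a < b := by linarith
  obtain ⟨u, v, hu⟩ := h.exists_arc (hab ▸ hL : LongEnough g m G B (b - a))
  rw [h.arcAction_eq (hab ▸ hL) hu]
  have f1 := h.action_ge hlt hu
  have f2 := h.action_le hlt hη0.le hC hu
  rw [hab] at f1 f2
  have g1 := mul_le_mul_of_nonneg_right hL1 (by positivity : 0 ≤ L ^ 3)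
  have g2 := mul_le_mul_of_nonneg_right hL2 (by positivity : 0 ≤ L ^ 3)
  have g3 := mul_le_mul_of_nonneg_right hηM (by positivity : 0 ≤ L ^ 3)
  have e1 : (B * M * L⁻¹ + (G - m) / 12 * (2 * B * L⁻¹ +
      deficit g G ((G - m) / 4) L / L) + C * (L⁻¹ * L⁻¹)) * L ^ 3 = B * M * L ^ 2 +
      (G - m) / 12 * (2 * B + deficit g G ((G - m) / 4) L) * L ^ 2 + C * L := by
    field_simp
  have e2 : ((G - m) * B * L⁻¹ + B ^ 2 / 2 * (L⁻¹ * L⁻¹)) * L ^ 3 =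
      (G - m) * B * L ^ 2 + B ^ 2 / 2 * L := by field_simp
  rw [e1] at g1
  rw [e2] at g2
  rw [abs_le]
  constructor <;> linarith

end PosForce

/-! ### Partitions of maximal total cost -/

/-- Two-periodic families of costs of arcs, of cubic size up to a relative error. -/
structure ArcCosts (c : ℕ → ℝ → ℝ → ℝ) (α : ℕ → ℝ) (lo hi h ε δ T : ℝ) : Prop where
  per : ∀ i, c (i + 2) = c i
  per_coeff : ∀ i, α (i + 2) = α i
  lo_pos : 0 < lo
  lo_le : ∀ i, lo ≤ α i
  le_hi : ∀ i, α i ≤ hi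
  h_pos : 0 < h
  ε_pos : 0 < ε
  ε_le : ε ≤ lo / 10
  δ_pos : 0 < δ
  δ_le : δ ≤ 1 / 2
  move : ∀ i, (α i + ε) * (1 - δ) ^ 3 + 8 * (α (i + 1) + ε) * δ ^ 3 < α i - ε
  trans : ∀ i a b, h ≤ b - a → ∀ z : ℤ, c i (a + z * T) (b + z * T) = c i a b
  cont : ∀ i a b, h ≤ b - a → ContinuousAt (fun x : ℝ × ℝ => c i x.1 x.2) (a, b)
  asymp : ∀ i a b, h ≤ b - a → |c i a b + α i * (b - a) ^ 3| ≤ ε * (b - a) ^ 3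

/-- The total cost of a partition. -/
def totalCost (c : ℕ → ℝ → ℝ → ℝ) (N : ℕ) (t : ℕ → ℝ) : ℝ :=
  ∑ i ∈ Finset.range N, c i (t i) (t (i + 1))

/-- Partitions of an interval of length `τ` into `N` pieces of length at least `h`. -/
def Admissible (N : ℕ) (h τ : ℝ) (t : ℕ → ℝ) : Prop :=
  t N = t 0 + τ ∧ ∀ i < N, h ≤ t (i + 1) - t i

/-- Quasi-periodic partitions maximizing the total cost. -/
structure IsMaxPartition (c : ℕ → ℝ → ℝ → ℝ) (N : ℕ) (h τ : ℝ) (t : ℕ → ℝ) : Prop where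
  quasi : ∀ i, t (i + N) = t i + τ
  gap : ∀ i, h ≤ t (i + 1) - t i
  max : ∀ s, Admissible N h τ s → totalCost c N s ≤ totalCost c N t

namespace ArcCosts

variable {c : ℕ → ℝ → ℝ → ℝ} {α : ℕ → ℝ} {lo hi h ε δ T τ : ℝ} {N : ℕ} {t : ℕ → ℝ}

/-- Relabelling by one index lets statements about arbitrary nodes be proved for the first few nodes
only. -/
lemma rotate (hc : ArcCosts c α lo hi h ε δ T) :
    ArcCosts (fun i => c (i + 1)) (fun i => α (i + 1)) lo hi h ε δ T where
  per i := hc.per (i + 1)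
  per_coeff i := hc.per_coeff (i + 1)
  lo_pos := hc.lo_pos
  lo_le _ := hc.lo_le _
  le_hi _ := hc.le_hi _
  h_pos := hc.h_pos
  ε_pos := hc.ε_pos
  ε_le := hc.ε_le
  δ_pos := hc.δ_pos
  δ_le := hc.δ_le
  move _ := hc.move _
  trans _ := hc.trans _
  cont _ := hc.cont _
  asymp _ := hc.asymp _

lemma rotate_iter (hc : ArcCosts c α lo hi h ε δ T) (k : ℕ) :
    ArcCosts (fun i => c (i + k)) (fun i => α (i + k)) lo hi h ε δ T := by
  induction k with
  | zero => exact hc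
  | succ k ih =>
    have := ih.rotate
    simpa only [add_assoc, add_comm 1 k] using this

lemma per_add (hc : ArcCosts c α lo hi h ε δ T) (hN : Even N) (i : ℕ) : c (i + N) = c i := by
  obtain ⟨k, rfl⟩ := hN
  induction k with
  | zero => rfl
  | succ k ih => rw [show i + (k + 1 + (k + 1)) = i + (k + k) + 2 by ring, hc.per, ih]

lemma totalCost_translate (hc : ArcCosts c α lo hi h ε δ T) (ht : ∀ i < N, h ≤ t (i + 1) - t i)
    (z : ℤ) : totalCost c N (fun i => t i + z * T) = totalCost c N t :=
  Finset.sum_congr rfl fun i hi => hc.trans i _ _ (ht i (Finset.mem_range.1 hi)) z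

/-- Translation by multiples of `T` preserves the cost, so the first node may be placed in `[0, T)`.
The remaining nodes then lie in `[0, T + τ]`, and a continuous function on a compact set attains its
maximum. -/
theorem exists_isMaxPartition (hc : ArcCosts c α lo hi h ε δ T) (hT : 0 < T) (hN : 0 < N)
    (hτ : N * h ≤ τ) : ∃ t, IsMaxPartition c N h τ t := by
  have hh := hc.h_pos
  have hN' : (0 : ℝ) < N := by exact_mod_cast hN
  have hτ0 : 0 < τ := (mul_pos hN' hh).trans_le hτ
  set S : Set (ℕ → ℝ) := {t | Admissible N h τ t} ∩ univ.pi fun _ => Icc 0 (T + τ) with hS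
  have hclosed : IsClosed {t : ℕ → ℝ | Admissible N h τ t} := by
    have : {t : ℕ → ℝ | Admissible N h τ t} =
        {t | t N = t 0 + τ} ∩ ⋂ i, ⋂ (_ : i < N), {t | h ≤ t (i + 1) - t i} := by
      ext t; simp [Admissible]
    rw [this]
    exact (isClosed_eq (by fun_prop) (by fun_prop)).inter
      (isClosed_iInter fun i => isClosed_iInter fun _ =>
        isClosed_le (by fun_prop) (by fun_prop))
  have hcomp : IsCompact S := (isCompact_univ_pi fun _ => isCompact_Icc).inter_left hclosed
  have hred : ∀ s, Admissible N h τ s → ∃ s' ∈ S, totalCost c N s' = totalCost c N s := by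
    intro s hs
    obtain ⟨z, hz, -⟩ := existsUnique_add_zsmul_mem_Ico hT (s 0) 0
    rw [zsmul_eq_mul, zero_add] at hz
    have hmono : ∀ j, ∀ i ≤ j, j ≤ N → s i ≤ s j := by
      intro j
      induction j with
      | zero => intro i hi _; rw [Nat.le_zero.1 hi]
      | succ j ih =>
        intro i hi hj
        rcases Nat.lt_or_ge j i with h1 | h1
        · rw [le_antisymm hi h1]
        · have := hs.2 j (by omega)
          linarith [ih i h1 (by omega)]
    have hmin : ∀ i < N, min i N = i ∧ min (i + 1) N = i + 1 := fun i hi => by omega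
    -- Entries beyond `N` do not enter the cost; they are frozen so that the whole sequence stays in
    -- the compact box.
    refine ⟨fun i => s (min i N) + z * T, ⟨⟨?_, fun i hi => ?_⟩, fun i _ => ?_⟩, ?_⟩
    · simp only [min_self, Nat.zero_min]; rw [hs.1]; ring
    · simp only [(hmin i hi).1, (hmin i hi).2]; linarith [hs.2 i hi]
    · have h1 := hmono (min i N) 0 (Nat.zero_le _) (min_le_right _ _)
      have h2 := hmono N (min i N) (min_le_right _ _) le_rfl
      rw [hs.1] at h2
      constructor
      · linarith [hz.1]
      · linarith [hz.2]
    · rw [hc.totalCost_translate (t := fun i => s (min i N)) fun i hi => by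
        rw [(hmin i hi).1, (hmin i hi).2]; exact hs.2 i hi]
      refine Finset.sum_congr rfl fun i hi => ?_
      have := hmin i (Finset.mem_range.1 hi)
      simp only [this.1, this.2]
  have hne : S.Nonempty := by
    have h1 : Admissible N h τ fun i => i * (τ / N) := by
      constructor
      · field_simp; simp
      · intro i _
        have : h ≤ τ / N := by rw [le_div_iff₀ hN']; linarith
        push_cast; linarith
    obtain ⟨s', hs', -⟩ := hred _ h1
    exact ⟨s', hs'⟩
  have hcont : ContinuousOn (totalCost c N) S := by
    refine continuousOn_finsetSum _ fun i hi t ht => ?_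
    have h1 := hc.cont i (t i) (t (i + 1)) (ht.1.2 i (Finset.mem_range.1 hi))
    have h2 : ContinuousAt (fun t : ℕ → ℝ => (t i, t (i + 1))) t :=
      ((continuous_apply _).prodMk (continuous_apply _)).continuousAt
    exact (ContinuousAt.comp (f := fun t : ℕ → ℝ => (t i, t (i + 1))) h1 h2).continuousWithinAt
  obtain ⟨t, htS, htmax⟩ := hcomp.exists_isMaxOn hne hcont
  have hmod : ∀ i < N, (i % N = i ∧ i / N = 0) := fun i hi =>
    ⟨Nat.mod_eq_of_lt hi, Nat.div_eq_of_lt hi⟩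
  have hsucc : ∀ i < N, t ((i + 1) % N) + ((i + 1) / N : ℕ) * τ = t (i + 1) := by
    intro i hi
    rcases Nat.lt_or_ge (i + 1) N with h1 | h1
    · rw [(hmod _ h1).1, (hmod _ h1).2]; simp
    · have : i + 1 = N := by omega
      rw [this, Nat.mod_self, Nat.div_self hN, htS.1.1]; simp
  have hstep : ∀ i, t ((i + 1) % N) + ((i + 1) / N : ℕ) * τ =
      t (i % N + 1) + (i / N : ℕ) * τ := by
    intro i
    have h1 := hsucc (i % N) (Nat.mod_lt _ hN)
    have h2 : i + 1 = (i % N + 1) + N * (i / N) := by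
      have := Nat.mod_add_div i N; omega
    rw [h2, Nat.add_mul_mod_self_left, Nat.add_mul_div_left _ _ hN, ← h1]
    push_cast; ring
  -- The maximizer is extended quasi-periodically from its first `N` nodes.
  refine ⟨fun i => t (i % N) + (i / N : ℕ) * τ, fun i => ?_, fun i => ?_, fun s hs => ?_⟩
  · simp only [Nat.add_mod_right, Nat.add_div_right i hN]
    push_cast; ring
  · rw [hstep i]
    have := htS.1.2 (i % N) (Nat.mod_lt _ hN)
    linarith
  · obtain ⟨s', hs', hss'⟩ := hred s hs
    rw [← hss']
    refine (htmax hs').trans (le_of_eq (Finset.sum_congr rfl fun i hi => ?_))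
    have hi' := Finset.mem_range.1 hi
    simp only [hsucc i hi', (hmod i hi').1, (hmod i hi').2]
    simp

end ArcCosts

namespace IsMaxPartition

variable {c : ℕ → ℝ → ℝ → ℝ} {α : ℕ → ℝ} {lo hi h ε δ T τ : ℝ} {N : ℕ} {t : ℕ → ℝ}

lemma admissible (ht : IsMaxPartition c N h τ t) : Admissible N h τ t :=
  ⟨by simpa using ht.quasi 0, fun i _ => ht.gap i⟩

lemma rotate (ht : IsMaxPartition c N h τ t) (hc : ArcCosts c α lo hi h ε δ T) (hN : Even N)
    (hN0 : 0 < N) {n : ℕ} (hτ : τ = n * T) :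
    IsMaxPartition (fun i => c (i + 1)) N h τ (fun i => t (i + 1)) := by
  obtain ⟨N, rfl⟩ := Nat.exists_eq_succ_of_ne_zero hN0.ne'
  have hshift : ∀ i a b, h ≤ b - a → c i (a + τ) (b + τ) = c i a b := fun i a b hab => by
    have := hc.trans i a b hab n
    rw [hτ]; exact_mod_cast this
  have hcN : c (N + 1) = c 0 := by simpa using hc.per_add hN 0
  refine ⟨fun i => ?_, fun i => ht.gap (i + 1), fun s hs => ?_⟩
  · rw [← ht.quasi (i + 1)]; congr 1; ring
  -- The last arc of the competitor is translated by `-τ` and put in front; its cost is unchanged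
  -- because `τ` is a multiple of `T` and `N` is even.
  · have key := ht.max (fun i => if i = 0 then s N - τ else s (i - 1)) ⟨?_, fun i hi => ?_⟩
    · have e1 : totalCost c (N + 1) (fun i => if i = 0 then s N - τ else s (i - 1)) =
          totalCost (fun i => c (i + 1)) (N + 1) s := by
        rw [totalCost, totalCost, Finset.sum_range_succ', Finset.sum_range_succ]
        congr 1
        simp only [if_true, Nat.zero_add, one_ne_zero, if_false, Nat.sub_self]
        have := hshift 0 (s N - τ) (s 0) (by have := hs.2 N (by omega); have := hs.1; grind)
        rw [← this, hcN, hs.1]; congr 1; ring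
      have e2 : totalCost c (N + 1) t =
          totalCost (fun i => c (i + 1)) (N + 1) (fun i => t (i + 1)) := by
        rw [totalCost, totalCost, Finset.sum_range_succ', Finset.sum_range_succ]
        congr 1
        have q1 := ht.quasi 0
        have q2 := ht.quasi 1
        rw [zero_add] at q1
        rw [show N + 1 + 1 = 1 + (N + 1) by ring, q1, q2, hcN, zero_add, hshift]
        exact ht.gap 0
      rw [← e1, ← e2]; exact key
    · simp
    · have h1 := hs.1
      rcases i with _ | i
      · have := hs.2 N (by omega)
        simp only [if_true, zero_add, one_ne_zero, if_false, Nat.sub_self]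
        linarith
      · have := hs.2 i (by omega)
        simpa using this

lemma rotate_iter (ht : IsMaxPartition c N h τ t) (hc : ArcCosts c α lo hi h ε δ T) (hN : Even N)
    (hN0 : 0 < N) {n : ℕ} (hτ : τ = n * T) (k : ℕ) :
    IsMaxPartition (fun i => c (i + k)) N h τ (fun i => t (i + k)) := by
  induction k with
  | zero => exact ht
  | succ k ih =>
    have := ih.rotate (hc.rotate_iter k) hN hN0 hτ
    simpa only [add_assoc, add_comm 1 k] using this

lemma cost_move_le (ht : IsMaxPartition c N h τ t) (hN : 2 ≤ N) {s : ℝ} (h0 : h ≤ s - t 0)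
    (h2 : h ≤ t 2 - s) :
    c 0 (t 0) s + c 1 s (t 2) ≤ c 0 (t 0) (t 1) + c 1 (t 1) (t 2) := by
  obtain ⟨N, rfl⟩ := Nat.exists_eq_add_of_le hN
  rw [add_comm 2 N] at ht
  have key := ht.max (fun i => if i = 1 then s else t i) ⟨?_, fun i _ => ?_⟩
  · rw [totalCost, totalCost, Finset.sum_range_succ', Finset.sum_range_succ',
      Finset.sum_range_succ', Finset.sum_range_succ'] at key
    simp at key
    linarith
  · have := ht.admissible.1
    simpa using this
  · rcases i with _ | _ | i
    · simpa using h0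
    · simpa using h2
    · simpa using ht.gap (i + 2)

end IsMaxPartition

namespace ArcCosts

variable {c : ℕ → ℝ → ℝ → ℝ} {α : ℕ → ℝ} {lo hi h ε δ T τ : ℝ} {N : ℕ} {t : ℕ → ℝ}

lemma cost_le (hc : ArcCosts c α lo hi h ε δ T) {a b : ℝ} (hab : h ≤ b - a) (i : ℕ) :
    c i a b ≤ -((α i - ε) * (b - a) ^ 3) := by
  have := (abs_le.1 (hc.asymp i a b hab)).2
  linarith

lemma le_cost (hc : ArcCosts c α lo hi h ε δ T) {a b : ℝ} (hab : h ≤ b - a) (i : ℕ) :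
    -((α i + ε) * (b - a) ^ 3) ≤ c i a b := by
  have := (abs_le.1 (hc.asymp i a b hab)).1
  linarith

lemma sub_ε_pos (hc : ArcCosts c α lo hi h ε δ T) (i : ℕ) : 0 < α i - ε := by
  linarith [hc.ε_le, hc.lo_pos, hc.lo_le i]

lemma cost_nonpos (hc : ArcCosts c α lo hi h ε δ T) {a b : ℝ} (hab : h ≤ b - a) (i : ℕ) :
    c i a b ≤ 0 := by
  have h1 := hc.cost_le hab i
  have h2 := hc.sub_ε_pos i
  have h3 : 0 ≤ b - a := by linarith [hc.h_pos]
  have : 0 ≤ (α i - ε) * (b - a) ^ 3 := by positivity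
  linarith

/-- Shifting the common end of a long and a shortest arc increases the cost. -/
lemma shift_gain (hc : ArcCosts c α lo hi h ε δ T) (i : ℕ) {X : ℝ} (hX : h < δ * X) :
    -((α i - ε) * X ^ 3) <
      -((α i + ε) * ((1 - δ) * X) ^ 3) - (α (i + 1) + ε) * (h + δ * X) ^ 3 := by
  have hX0 : 0 < X := pos_of_mul_pos_right (hc.h_pos.trans hX) hc.δ_pos.le
  -- Here `h < δ X` is used; the cube of the factor two is the `8` in the hypothesis `move`.
  have h1 : (h + δ * X) ^ 3 ≤ (2 * (δ * X)) ^ 3 :=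
    pow_le_pow_left₀ (by have := hc.h_pos; linarith) (by linarith) 3
  have h2 : 0 ≤ α (i + 1) + ε := by linarith [hc.lo_pos, hc.lo_le (i + 1), hc.ε_pos]
  have h3 := mul_le_mul_of_nonneg_left h1 h2
  have h4 := mul_lt_mul_of_pos_right (hc.move i) (pow_pos hX0 3)
  nlinarith

end ArcCosts

namespace IsMaxPartition

variable {c : ℕ → ℝ → ℝ → ℝ} {α : ℕ → ℝ} {lo hi h ε δ T τ : ℝ} {N : ℕ} {t : ℕ → ℝ}

/-- Next to an arc of minimal length `h`, an arc of length `X > h/δ` could give up `δ X` to it, and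
by `shift_gain` the total cost would increase. -/
lemma left_le (ht : IsMaxPartition c N h τ t) (hc : ArcCosts c α lo hi h ε δ T) (hN : 2 ≤ N)
    (hs : t 2 - t 1 = h) : t 1 - t 0 ≤ h / δ := by
  by_contra! hlt
  set X := t 1 - t 0 with hX
  have hh := hc.h_pos
  have hδX : h < δ * X := by rw [div_lt_iff₀ hc.δ_pos] at hlt; linarith
  have hX0 : 0 < X := pos_of_mul_pos_right (hh.trans hδX) hc.δ_pos.le
  have hd := mul_le_mul_of_nonneg_right hc.δ_le hX0.le
  have e1 : t 1 - δ * X - t 0 = (1 - δ) * X := by rw [hX]; ring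
  have e2 : t 2 - (t 1 - δ * X) = h + δ * X := by rw [← hs]; ring
  have g1 : h ≤ t 1 - δ * X - t 0 := by rw [e1]; linarith
  have g2 : h ≤ t 2 - (t 1 - δ * X) := by rw [e2]; linarith
  have key := ht.cost_move_le hN g1 g2
  have f1 := hc.le_cost g1 0
  have f2 := hc.le_cost g2 1
  have f3 := hc.cost_le (ht.gap 0) 0
  have f4 := hc.cost_nonpos (ht.gap 1) 1
  have f5 := hc.shift_gain 0 hδX
  rw [e1] at f1
  rw [e2] at f2
  simp only [zero_add, one_add_one_eq_two, ← hX] at f3 f4 f5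
  linarith

lemma right_le (ht : IsMaxPartition c N h τ t) (hc : ArcCosts c α lo hi h ε δ T) (hN : 2 ≤ N)
    (hs : t 1 - t 0 = h) : t 2 - t 1 ≤ h / δ := by
  by_contra! hlt
  set X := t 2 - t 1 with hX
  have hh := hc.h_pos
  have hδX : h < δ * X := by rw [div_lt_iff₀ hc.δ_pos] at hlt; linarith
  have hX0 : 0 < X := pos_of_mul_pos_right (hh.trans hδX) hc.δ_pos.le
  have hd := mul_le_mul_of_nonneg_right hc.δ_le hX0.le
  have e1 : t 1 + δ * X - t 0 = h + δ * X := by rw [← hs]; ring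
  have e2 : t 2 - (t 1 + δ * X) = (1 - δ) * X := by rw [hX]; ring
  have g1 : h ≤ t 1 + δ * X - t 0 := by rw [e1]; linarith
  have g2 : h ≤ t 2 - (t 1 + δ * X) := by rw [e2]; linarith
  have key := ht.cost_move_le hN g1 g2
  have f1 := hc.le_cost g1 0
  have f2 := hc.le_cost g2 1
  have f3 := hc.cost_nonpos (ht.gap 0) 0
  have f4 := hc.cost_le (ht.gap 1) 1
  have f5 := hc.shift_gain 1 hδX
  rw [e1] at f1
  rw [e2] at f2
  have e3 : α 2 = α 0 := by simpa using hc.per_coeff 0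
  simp only [zero_add, one_add_one_eq_two, ← hX, e3] at f3 f4 f5
  linarith

/-- Deleting the two inner points of the first three arcs and inserting two points in another
arc does not increase the cost. -/
lemma surgery_le (ht : IsMaxPartition c N h τ t) (hc : ArcCosts c α lo hi h ε δ T) {r q : ℕ}
    (hN : N = r + 4 + q) {p₁ p₂ : ℝ} (h1 : h ≤ p₁ - t (r + 3)) (h2 : h ≤ p₂ - p₁)
    (h3 : h ≤ t (r + 4) - p₂) :
    c 0 (t 0) (t 3) + (c (r + 3) (t (r + 3)) p₁ + c (r + 4) p₁ p₂ + c (r + 3) p₂ (t (r + 4))) ≤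
      c 0 (t 0) (t 1) + c 1 (t 1) (t 2) + c 2 (t 2) (t 3) +
        c (r + 3) (t (r + 3)) (t (r + 4)) := by
  subst hN
  have hh := hc.h_pos
  -- The nodes `t 3, …, t (r + 3)` move down by two indices, which preserves the signs of their
  -- arcs, and `p₁`, `p₂` fill the two freed places.
  set s : ℕ → ℝ := fun j => if j = 0 then t 0 else if j ≤ r + 1 then t (j + 2) else
    if j = r + 2 then p₁ else if j = r + 3 then p₂ else t j with hs
  have s0 : s 0 = t 0 := by simp [hs]
  have s1 : ∀ j ≤ r, s (j + 1) = t (j + 3) := fun j hj => by simp [hs, hj]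
  have s2 : s (r + 2) = p₁ := by simp [hs]
  have s3 : s (r + 3) = p₂ := by simp [hs]
  have s4 : ∀ j, s (r + 4 + j) = t (r + 4 + j) := fun j => by
    simp only [hs]
    rw [if_neg (by omega), if_neg (by omega), if_neg (by omega), if_neg (by omega)]
  have hadm : Admissible (r + 4 + q) h τ s := by
    refine ⟨by rw [s4, s0]; exact ht.admissible.1, fun i _ => ?_⟩
    rcases Nat.lt_or_ge i (r + 4) with hi | hi
    · rcases i with _ | i
      · rw [s1 0 (Nat.zero_le _), s0]
        have a1 := ht.gap 0
        have a2 := ht.gap 1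
        have a3 := ht.gap 2
        simp only [zero_add, one_add_one_eq_two] at a1 a2 a3 ⊢
        norm_num at a3
        linarith
      · rcases Nat.lt_or_ge i r with hir | hir
        · rw [s1 (i + 1) hir, s1 i hir.le]
          exact ht.gap (i + 3)
        · obtain rfl | rfl | rfl : i = r ∨ i = r + 1 ∨ i = r + 2 := by omega
          · rw [s2, s1 _ le_rfl]; exact h1
          · rw [s3, s2]; exact h2
          · have := s4 0
            rw [add_zero] at this
            rw [this, s3]; exact h3
    · obtain ⟨j, rfl⟩ := Nat.exists_eq_add_of_le hi
      rw [add_assoc, s4, s4]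
      exact ht.gap _
  have key := ht.max s hadm
  have es : totalCost c (r + 4 + q) s = c 0 (t 0) (t 3) +
      (∑ j ∈ Finset.range r, c (j + 3) (t (j + 3)) (t (j + 4))) +
      (c (r + 3) (t (r + 3)) p₁ + c (r + 4) p₁ p₂ + c (r + 3) p₂ (t (r + 4))) +
      ∑ j ∈ Finset.range q, c (r + 4 + j) (t (r + 4 + j)) (t (r + 4 + j + 1)) := by
    rw [totalCost, Finset.sum_range_add]
    congr 1
    · rw [show r + 4 = r + 1 + 1 + 1 + 1 by ring, Finset.sum_range_succ, Finset.sum_range_succ,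
        Finset.sum_range_succ, Finset.sum_range_succ']
      have e4 : s (r + 1 + 1 + 1 + 1) = t (r + 4) := by simpa using s4 0
      have ec1 : c (r + 1) = c (r + 3) := (hc.per (r + 1)).symm
      have ec2 : c (r + 1 + 1) = c (r + 4) := (hc.per (r + 2)).symm
      rw [e4, s0, s1 0 (Nat.zero_le _), s1 r le_rfl, ec1, ec2]
      rw [show s (r + 1 + 1) = p₁ from s2, show s (r + 1 + 1 + 1) = p₂ from s3]
      have : ∑ i ∈ Finset.range r, c (i + 1) (s (i + 1)) (s (i + 1 + 1)) =
          ∑ j ∈ Finset.range r, c (j + 3) (t (j + 3)) (t (j + 4)) := by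
        refine Finset.sum_congr rfl fun i hi => ?_
        have hi' := Finset.mem_range.1 hi
        rw [s1 i hi'.le, s1 (i + 1) hi', ← hc.per (i + 1)]
      rw [this, zero_add]
      rw [show c (r + 1 + 1 + 1) = c (r + 3) from rfl, show r + 1 + 1 + 1 + 1 = r + 4 from rfl]
      ring
    · refine Finset.sum_congr rfl fun j _ => ?_
      rw [s4, show s (r + 4 + j + 1) = t (r + 4 + j + 1) from s4 (j + 1)]
  have et : totalCost c (r + 4 + q) t = c 0 (t 0) (t 1) + c 1 (t 1) (t 2) + c 2 (t 2) (t 3) +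
      (∑ j ∈ Finset.range r, c (j + 3) (t (j + 3)) (t (j + 4))) +
      c (r + 3) (t (r + 3)) (t (r + 4)) +
      ∑ j ∈ Finset.range q, c (r + 4 + j) (t (r + 4 + j)) (t (r + 4 + j + 1)) := by
    rw [totalCost, Finset.sum_range_add]
    congr 1
    rw [show r + 4 = r + 1 + 1 + 1 + 1 by ring, Finset.sum_range_succ, Finset.sum_range_succ',
      Finset.sum_range_succ', Finset.sum_range_succ']
    simp only [zero_add, add_assoc, Nat.reduceAdd]
    ring
  rw [es, et] at key
  linarith

/-- If three consecutive arcs are short in total, merging them costs little, whereas splitting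
another arc of length `X` saves a multiple of `X³`. Maximality therefore bounds `X`. -/
lemma arc_le (ht : IsMaxPartition c N h τ t) (hc : ArcCosts c α lo hi h ε δ T) {r q : ℕ}
    (hN : N = r + 4 + q) {D : ℝ} (hD : t 3 - t 0 ≤ D) :
    t (r + 4) - t (r + 3) ≤ 3 * h + 1 + 4 * (hi / lo) * (D ^ 3 + h ^ 3) := by
  have hh := hc.h_pos
  have hlo := hc.lo_pos
  have hε := hc.ε_pos
  have hhi : lo ≤ hi := (hc.lo_le 0).trans (hc.le_hi 0)
  have a0 := ht.gap 0
  have a1 := ht.gap 1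
  have a2 := ht.gap 2
  simp only [zero_add, one_add_one_eq_two] at a0 a1 a2
  norm_num at a2
  have h03 : h ≤ t 3 - t 0 := by linarith
  have hD0 : 0 < D := by linarith
  have hR0 : 0 ≤ 4 * (hi / lo) * (D ^ 3 + h ^ 3) := by
    have : 0 < hi := by linarith
    positivity
  set X := t (r + 4) - t (r + 3) with hX
  by_contra! hlt
  have hX3 : 3 * h < X := by linarith
  have hX1 : 1 < X := by linarith
  -- The long arc is split into lengths `y, h, y`. The bound `3 h < X` gives `y ≥ h`, and `1 < X`
  -- allows `X³` to be replaced by `X` below.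
  set y := (X - h) / 2 with hy
  have e1 : t (r + 3) + y - t (r + 3) = y := by ring
  have e2 : t (r + 3) + y + h - (t (r + 3) + y) = h := by ring
  have e3 : t (r + 4) - (t (r + 3) + y + h) = y := by rw [hy, hX]; ring
  have g1 : h ≤ t (r + 3) + y - t (r + 3) := by rw [e1]; linarith
  have g2 : h ≤ t (r + 3) + y + h - (t (r + 3) + y) := by rw [e2]
  have g3 : h ≤ t (r + 4) - (t (r + 3) + y + h) := by rw [e3]; linarith
  have key := ht.surgery_le hc hN g1 g2 g3
  have f0 := hc.le_cost h03 0
  have f1 := hc.le_cost g1 (r + 3)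
  have f2 := hc.le_cost g2 (r + 4)
  have f3 := hc.le_cost g3 (r + 3)
  have f4 := hc.cost_nonpos a0 0
  have f5 := hc.cost_nonpos a1 1
  have f6 := hc.cost_nonpos a2 2
  have f7 := hc.cost_le (ht.gap (r + 3)) (r + 3)
  rw [e1] at f1
  rw [e2] at f2
  rw [e3] at f3
  rw [show r + 3 + 1 = r + 4 by ring, ← hX] at f7
  have b0 : (α 0 + ε) * (t 3 - t 0) ^ 3 ≤ 2 * hi * D ^ 3 :=
    mul_le_mul (by linarith [hc.le_hi 0, hc.ε_le])
      (pow_le_pow_left₀ (by linarith) hD 3) (pow_nonneg (by linarith) 3) (by linarith)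
  have b2 : (α (r + 4) + ε) * h ^ 3 ≤ 2 * hi * h ^ 3 :=
    mul_le_mul_of_nonneg_right (by linarith [hc.le_hi (r + 4), hc.ε_le]) (by positivity)
  have hαl := hc.lo_le (r + 3)
  have b1 : (α (r + 3) + ε) * y ^ 3 ≤ (α (r + 3) + ε) * (X / 2) ^ 3 :=
    mul_le_mul_of_nonneg_left (pow_le_pow_left₀ (by linarith) (by linarith) 3) (by linarith)
  have hX3' : X ≤ X ^ 3 := le_self_pow₀ hX1.le (by norm_num)
  have b3 : (α (r + 3) - ε) * X ^ 3 - 2 * ((α (r + 3) + ε) * (X / 2) ^ 3) ≤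
      2 * hi * (D ^ 3 + h ^ 3) := by linarith
  have b4 : lo / 2 * X ≤
      (α (r + 3) - ε) * X ^ 3 - 2 * ((α (r + 3) + ε) * (X / 2) ^ 3) := by
    have : (α (r + 3) - ε) * X ^ 3 - 2 * ((α (r + 3) + ε) * (X / 2) ^ 3) =
      (3 / 4 * α (r + 3) - 5 / 4 * ε) * X ^ 3 := by ring
    rw [this]
    exact mul_le_mul (by linarith [hc.ε_le]) hX3' (by linarith) (by linarith [hc.ε_le])
  have b5 : X ≤ 4 * (hi / lo) * (D ^ 3 + h ^ 3) := by
    have : 4 * (hi / lo) * (D ^ 3 + h ^ 3) = 2 * hi * (D ^ 3 + h ^ 3) / (lo / 2) := by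
      field_simp; ring
    rw [this, le_div_iff₀ (by linarith)]
    linarith
  linarith

/-- An average gap above this bound forces all gaps of a maximal partition to exceed `h`. -/
noncomputable def gapBound (lo hi h δ : ℝ) : ℝ :=
  h / δ + (3 * h + 1 + 4 * (hi / lo) * ((3 * (h / δ)) ^ 3 + h ^ 3)) + 1

/-- An arc of length exactly `h` has neighbours of length at most `h/δ`, and `arc_le` with `D = 3
h/δ` then bounds every other arc. All gaps are at most `gapBound - 1`, so their sum is less than
`gapBound * N`, a contradiction. -/
theorem gap_lt (ht : IsMaxPartition c N h τ t) (hc : ArcCosts c α lo hi h ε δ T) (hN : Even N)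
    (hN0 : 0 < N) {n : ℕ} (hτ : τ = n * T) (hbig : gapBound lo hi h δ * N ≤ τ) (i : ℕ) :
    h < t (i + 1) - t i := by
  refine lt_of_le_of_ne (ht.gap i) fun hi0 => ?_
  have hN2 : 2 ≤ N := by obtain ⟨k, rfl⟩ := hN; omega
  have hh := hc.h_pos
  have hhd : h ≤ h / δ := by
    rw [le_div_iff₀ hc.δ_pos]
    have := mul_le_mul_of_nonneg_left hc.δ_le hh.le
    linarith
  have hhi : 0 < hi := hc.lo_pos.trans_le ((hc.lo_le 0).trans (hc.le_hi 0))
  have hlo := hc.lo_pos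
  have hhd0 : 0 < h / δ := div_pos hh hc.δ_pos
  have hR0 : 0 ≤ 4 * (hi / lo) * ((3 * (h / δ)) ^ 3 + h ^ 3) := by positivity
  -- The index just before gap `i`, moved up by one period so that it is a natural number also for
  -- `i = 0`.
  set k := i + N - 1 with hk
  have ht' := ht.rotate_iter hc hN hN0 hτ k
  have hc' := hc.rotate_iter k
  have ht'' := ht.rotate_iter hc hN hN0 hτ (k + 1)
  have hc'' := hc.rotate_iter (k + 1)
  have hshort : t (2 + k) - t (1 + k) = h := by
    have q1 := ht.quasi (i + 1)
    have q2 := ht.quasi i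
    rw [show 2 + k = i + 1 + N by omega, show 1 + k = i + N by omega, q1, q2, hi0]; ring
  have hl := ht'.left_le hc' hN2 hshort
  have hr := ht''.right_le hc'' hN2 (by
    rw [show 1 + (k + 1) = 2 + k by ring, show 0 + (k + 1) = 1 + k by ring]; exact hshort)
  rw [show 2 + (k + 1) = 3 + k by ring, show 1 + (k + 1) = 2 + k by ring] at hr
  have hall : ∀ j < N, t (j + 1 + k) - t (j + k) ≤ gapBound lo hi h δ - 1 := by
    intro j hj
    have hgb : gapBound lo hi h δ - 1 =
      h / δ + (3 * h + 1 + 4 * (hi / lo) * ((3 * (h / δ)) ^ 3 + h ^ 3)) := by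
      unfold gapBound; ring
    rw [hgb]
    rcases j with _ | _ | _ | r
    · simp only [zero_add] at hl ⊢; linarith
    · norm_num; linarith
    · norm_num; linarith
    · obtain ⟨q, hq⟩ := Nat.exists_eq_add_of_le (show r + 4 ≤ N by omega)
      have := ht'.arc_le hc' hq (D := 3 * (h / δ)) (by linarith)
      rw [show r + 1 + 1 + 1 + 1 + k = r + 4 + k by ring,
        show r + 1 + 1 + 1 + k = r + 3 + k by ring]
      linarith
  have hsum : ∑ j ∈ Finset.range N, (t (j + 1 + k) - t (j + k)) = τ := by
    rw [Finset.sum_range_sub (fun j => t (j + k))]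
    have := ht.quasi k
    rw [show N + k = k + N by ring, zero_add, this]; ring
  have hle := Finset.sum_le_card_nsmul (Finset.range N) _ _
    fun j hj => hall j (Finset.mem_range.1 hj)
  rw [hsum, Finset.card_range, nsmul_eq_mul] at hle
  have : (0 : ℝ) < N := by exact_mod_cast hN0
  linarith

lemma isLocalMax (ht : IsMaxPartition c N h τ t) (hc : ArcCosts c α lo hi h ε δ T) (hN : Even N)
    (hN0 : 0 < N) {n : ℕ} (hτ : τ = n * T) (hgap : ∀ i, h < t (i + 1) - t i) (i : ℕ) :
    IsLocalMax (fun s => c i (t i) s + c (i + 1) s (t (i + 2))) (t (i + 1)) := by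
  have hN2 : 2 ≤ N := by obtain ⟨k, rfl⟩ := hN; omega
  have ht' := ht.rotate_iter hc hN hN0 hτ i
  have h1 := hgap i
  have h2 := hgap (i + 1)
  filter_upwards [Ioo_mem_nhds (show t i + h < t (i + 1) by linarith)
    (show t (i + 1) < t (i + 2) - h by rw [show i + 2 = i + 1 + 1 by ring]; linarith)] with s hs
  have := ht'.cost_move_le hN2 (s := s) (by rw [zero_add]; linarith [hs.1])
    (by rw [add_comm 2 i]; linarith [hs.2])
  simpa only [zero_add, add_comm 2 i, add_comm 1 i] using this

end IsMaxPartition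

/-! ### Signed arcs and their gluing -/

/-- Arcs of alternating sign: positive for even index, negative for odd index. -/
def IsSignedArc (g p : ℝ → ℝ) (κ κ' : ℝ) (i : ℕ) (a b : ℝ) (u v : ℝ → ℝ) : Prop :=
  if Even i then IsArc g p κ a b u v
  else IsArc (fun s => -g (-s)) (fun t => -p t) κ' a b (fun t => -u t) (fun t => -v t)

/-- The action of signed arcs. -/
noncomputable def signedAction (g p : ℝ → ℝ) (κ κ' : ℝ) (i : ℕ) : ℝ → ℝ → ℝ :=
  if Even i then arcAction g p κ else arcAction (fun s => -g (-s)) (fun t => -p t) κ'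

/-- Force and forcing satisfying the hypotheses for positive and for negative arcs. -/
structure TwoSidedForce (g p : ℝ → ℝ) (m G G' M B : ℝ) (K : ℝ≥0) : Prop where
  pos : PosForce g p m G M B K
  neg : PosForce (fun s => -g (-s)) (fun t => -p t) (-m) G' M B K

lemma IsArc.left_velocity_nonneg {g p : ℝ → ℝ} {κ a b : ℝ} {u v : ℝ → ℝ} (hκ : 0 ≤ κ) (hab : a < b)
    (h : IsArc g p κ a b u v) : 0 ≤ v a := by
  have h1 : HasDerivWithinAt u (v a) (Ioi a) a := (h.deriv_fst a).hasDerivWithinAt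
  rw [hasDerivWithinAt_iff_tendsto_slope' (by simp)] at h1
  refine ge_of_tendsto h1 ?_
  filter_upwards [Ioo_mem_nhdsGT hab] with s hs
  rw [slope_def_field, h.left, sub_zero]
  exact div_nonneg (h.nonneg hκ (Ioo_subset_Icc_self hs)) (by linarith [hs.1])

lemma IsArc.right_velocity_nonpos {g p : ℝ → ℝ} {κ a b : ℝ} {u v : ℝ → ℝ} (hκ : 0 ≤ κ) (hab : a < b)
    (h : IsArc g p κ a b u v) : v b ≤ 0 := by
  have := h.comp_neg.left_velocity_nonneg hκ (neg_lt_neg hab)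
  simp only [neg_neg] at this
  linarith

namespace IsSignedArc

variable {g p : ℝ → ℝ} {κ κ' a b : ℝ} {u v : ℝ → ℝ} {i : ℕ}

lemma deriv_fst (h : IsSignedArc g p κ κ' i a b u v) (t : ℝ) : HasDerivAt u (v t) t := by
  unfold IsSignedArc at h
  split_ifs at h
  · exact h.deriv_fst t
  · simpa [Pi.neg_def] using (h.deriv_fst t).neg

lemma deriv_snd (h : IsSignedArc g p κ κ' i a b u v) {t : ℝ} (ht : t ∈ Icc a b) :
    HasDerivAt v (p t - g (u t)) t := by
  unfold IsSignedArc at h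
  split_ifs at h
  · exact h.deriv_snd t ht
  · have := (h.deriv_snd t ht).neg
    simp only [Pi.neg_def, neg_neg] at this
    exact this.congr_deriv (by ring)

lemma left (h : IsSignedArc g p κ κ' i a b u v) : u a = 0 := by
  unfold IsSignedArc at h
  split_ifs at h
  · exact h.left
  · simpa using h.left

lemma right (h : IsSignedArc g p κ κ' i a b u v) : u b = 0 := by
  unfold IsSignedArc at h
  split_ifs at h
  · exact h.right
  · simpa using h.right

lemma ne_zero (h : IsSignedArc g p κ κ' i a b u v) (hκ : 0 < κ) (hκ' : 0 < κ') {t : ℝ}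
    (ht : t ∈ Ioo a b) : u t ≠ 0 := by
  unfold IsSignedArc at h
  split_ifs at h
  · exact (h.pos hκ ht).ne'
  · simpa using (h.pos hκ' ht).ne'

lemma translate {τ : ℝ} (h : IsSignedArc g p κ κ' i a b u v) (hp : Function.Periodic p τ) {j : ℕ}
    (hj : Even j ↔ Even i) :
    IsSignedArc g p κ κ' j (a + τ) (b + τ) (fun t => u (t - τ)) (fun t => v (t - τ)) := by
  unfold IsSignedArc at h ⊢
  simp only [hj]
  split_ifs at h ⊢
  · exact h.translate hp
  · exact IsArc.translate h (fun t => by simp only [hp t])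

end IsSignedArc

namespace TwoSidedForce

variable {g p : ℝ → ℝ} {m G G' M B : ℝ} {K : ℝ≥0} {h₀ a b d : ℝ} {u v u' v' : ℝ → ℝ} {i : ℕ}

lemma exists_signedArc (hf : TwoSidedForce g p m G G' M B K)
    (hL : LongEnough g m G B (b - a)) (hL' : LongEnough (fun s => -g (-s)) (-m) G' B (b - a))
    (i : ℕ) : ∃ u v, IsSignedArc g p ((G - m) / 4) ((G' - -m) / 4) i a b u v := by
  unfold IsSignedArc
  split_ifs
  · exact hf.pos.exists_arc hL
  · obtain ⟨u, v, h⟩ := hf.neg.exists_arc hL'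
    exact ⟨fun t => -u t, fun t => -v t, by simpa only [neg_neg] using h⟩

/-- At a critical junction consecutive signed arcs have the same velocity. -/
lemma velocity_eq (hf : TwoSidedForce g p m G G' M B K)
    (hL : ∀ L, h₀ ≤ L → LongEnough g m G B L)
    (hL' : ∀ L, h₀ ≤ L → LongEnough (fun s => -g (-s)) (-m) G' B L) (h1 : 1 ≤ h₀)
    (hab : h₀ < b - a) (hbd : h₀ < d - b)
    (hu : IsSignedArc g p ((G - m) / 4) ((G' - -m) / 4) i a b u v)
    (hu' : IsSignedArc g p ((G - m) / 4) ((G' - -m) / 4) (i + 1) b d u' v')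
    (hmax : IsLocalMax (fun s => signedAction g p ((G - m) / 4) ((G' - -m) / 4) i a s +
      signedAction g p ((G - m) / 4) ((G' - -m) / 4) (i + 1) s d) b) : v b = v' b := by
  have hA := hf.pos.gap_pos
  have hA' := hf.neg.gap_pos
  -- Criticality equates the squared velocities. A positive arc arrives with velocity `≤ 0` and the
  -- next negative arc leaves with velocity `≤ 0` (reversed signs in the other case), so the product
  -- is nonnegative.
  have key : v b ^ 2 = v' b ^ 2 ∧ 0 ≤ v b * v' b := by
    unfold IsSignedArc at hu hu'
    unfold signedAction at hmax
    by_cases hi : Even i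
    · have hi1 : ¬ Even (i + 1) := by simpa [Nat.even_add_one] using hi
      rw [if_pos hi] at hu
      rw [if_neg hi1] at hu'
      simp only [if_pos hi, if_neg hi1] at hmax
      have d1 := hf.pos.hasDerivAt_arcAction_right hL h1 hab hu
      have d2 := hf.neg.hasDerivAt_arcAction_left hL' h1 hbd hu'
      have e := hmax.hasDerivAt_eq_zero (d1.add d2)
      have s1 := hu.right_velocity_nonpos (by linarith) (by linarith)
      have s2 := hu'.left_velocity_nonneg (by linarith) (by linarith)
      simp only [neg_sq] at e s2
      exact ⟨by linarith, mul_nonneg_of_nonpos_of_nonpos s1 (by linarith)⟩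
    · have hi1 : Even (i + 1) := by simpa [Nat.even_add_one] using hi
      rw [if_neg hi] at hu
      rw [if_pos hi1] at hu'
      simp only [if_neg hi, if_pos hi1] at hmax
      have d1 := hf.neg.hasDerivAt_arcAction_right hL' h1 hab hu
      have d2 := hf.pos.hasDerivAt_arcAction_left hL h1 hbd hu'
      have e := hmax.hasDerivAt_eq_zero (d1.add d2)
      have s1 := hu.right_velocity_nonpos (by linarith) (by linarith)
      have s2 := hu'.left_velocity_nonneg (by linarith) (by linarith)
      simp only [neg_sq] at e s1
      exact ⟨by linarith, mul_nonneg (by linarith) s2⟩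
  rcases sq_eq_sq_iff_eq_or_eq_neg.1 key.1 with h | h
  · exact h
  · have h2 := key.2
    rw [h] at h2
    have : v' b = 0 := by nlinarith
    rw [h, this, neg_zero]

theorem exists_arcCosts (hf : TwoSidedForce g p m G G' M B K) :
    ∃ (α : ℕ → ℝ) (lo hi h₀ ε δ : ℝ), 0 < lo ∧ lo ≤ hi ∧ 0 < δ ∧ 1 ≤ h₀ ∧
      (∀ L, h₀ ≤ L → LongEnough g m G B L) ∧
      (∀ L, h₀ ≤ L → LongEnough (fun s => -g (-s)) (-m) G' B L) ∧
      ∀ T, Function.Periodic p T →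
        ArcCosts (signedAction g p ((G - m) / 4) ((G' - -m) / 4)) α lo hi (h₀ + 1) ε δ T := by
  have hA := hf.pos.gap_pos
  have hA' := hf.neg.gap_pos
  set α₀ := (G - m) ^ 2 / 24 with hα₀
  set α₁ := (G' - -m) ^ 2 / 24 with hα₁
  have hα₀p : 0 < α₀ := by positivity
  have hα₁p : 0 < α₁ := by positivity
  set lo := min α₀ α₁ with hlo
  set hi := max α₀ α₁ with hhi
  have hlop : 0 < lo := lt_min hα₀p hα₁p
  have hlohi : lo ≤ hi := (min_le_left _ _).trans (le_max_left _ _)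
  have hhip : 0 < hi := hlop.trans_le hlohi
  set ρ := lo / hi with hρ
  have hρ0 : 0 < ρ := by positivity
  have hρ1 : ρ ≤ 1 := (div_le_one hhip).2 hlohi
  have hρhi : ρ * hi = lo := by rw [hρ]; field_simp
  -- In `move`, shortening the long arc gains at least `α δ ≥ lo δ`, while lengthening the other
  -- costs about `8 hi δ³`. With `δ` proportional to `lo / hi` the latter is at most half of the
  -- gain, and `10 ε = lo δ` covers the errors.
  set δ := ρ / 4 with hδ
  have hδ0 : 0 < δ := by positivity
  set ε := δ * lo / 10 with hε
  have hε0 : 0 < ε := by positivity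
  have hεlo : ε ≤ lo / 10 := by
    have := mul_le_mul_of_nonneg_right (by linarith : δ ≤ 1) hlop.le
    rw [hε]; linarith
  set α : ℕ → ℝ := fun i => if Even i then α₀ else α₁ with hα
  have hαlo : ∀ i, lo ≤ α i := fun i => by
    simp only [hα]; split_ifs
    exacts [min_le_left _ _, min_le_right _ _]
  have hαhi : ∀ i, α i ≤ hi := fun i => by
    simp only [hα]; split_ifs
    exacts [le_max_left _ _, le_max_right _ _]
  obtain ⟨h₀, hh₀⟩ := eventually_atTop.1 ((((hf.pos.eventually_longEnough).and
    hf.neg.eventually_longEnough).and ((hf.pos.arcAction_asymptotics hε0).and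
    (hf.neg.arcAction_asymptotics hε0))).and (eventually_ge_atTop 1))
  -- All constants precede `T`. The threshold `h₀ + 1` in place of `h₀` provides the strict
  -- inequality `h₀ < b - a` needed for continuity and differentiability.
  refine ⟨α, lo, hi, h₀, ε, δ, hlop, hlohi, hδ0, (hh₀ h₀ le_rfl).2, fun L hL => (hh₀ L hL).1.1.1,
    fun L hL => (hh₀ L hL).1.1.2, fun T hT => ?_⟩
  have h1 := (hh₀ h₀ le_rfl).2
  refine
    { per := fun i => by simp [signedAction, Nat.even_add]
      per_coeff := fun i => by simp [hα, Nat.even_add]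
      lo_pos := hlop
      lo_le := hαlo
      le_hi := hαhi
      h_pos := by linarith
      ε_pos := hε0
      ε_le := hεlo
      δ_pos := hδ0
      δ_le := by linarith
      move := fun i => ?_
      trans := fun i a b hab z => ?_
      cont := fun i a b hab => ?_
      asymp := fun i a b hab => ?_ }
  · have hδ1 : δ ≤ 1 / 4 := by linarith
    have a1 : (1 - δ) ^ 3 ≤ 1 - δ := by
      have := pow_le_pow_of_le_one (by linarith : 0 ≤ 1 - δ) (by linarith) (by norm_num : 1 ≤ 3)
      simpa using this
    have a2 : (α i + ε) * (1 - δ) ^ 3 ≤ (α i + ε) * (1 - δ) :=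
      mul_le_mul_of_nonneg_left a1 (by linarith [hαlo i])
    have a3 : (α (i + 1) + ε) * δ ^ 3 ≤ (hi + ε) * δ ^ 3 :=
      mul_le_mul_of_nonneg_right (by linarith [hαhi (i + 1)]) (by positivity)
    have a4 : hi * δ ^ 3 ≤ lo * δ / 16 := by
      have e : hi * δ ^ 3 = lo * δ / 16 * ρ := by
        rw [← hρhi, hδ]; ring
      rw [e]
      exact mul_le_of_le_one_right (by positivity) hρ1
    have a5 : ε * δ ^ 3 ≤ ε * (1 / 64) := by
      have := pow_le_pow_left₀ hδ0.le hδ1 3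
      exact mul_le_mul_of_nonneg_left (by norm_num at this ⊢; linarith) hε0.le
    have a6 : lo * δ ≤ α i * δ := mul_le_mul_of_nonneg_right (hαlo i) hδ0.le
    have a7 : 0 ≤ ε * δ := by positivity
    have a8 : 10 * ε = lo * δ := by rw [hε]; ring
    linarith
  · have hz := hT.int_mul z
    unfold signedAction
    split_ifs
    · exact hf.pos.arcAction_translate (hh₀ _ (by linarith)).1.1.1 hz
    · exact hf.neg.arcAction_translate (hh₀ _ (by linarith)).1.1.2 (fun t => by simp only [hz t])
  · unfold signedAction
    split_ifs
    · exact hf.pos.continuousAt_arcAction (fun L hL => (hh₀ L hL).1.1.1) h1 (by linarith)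
    · exact hf.neg.continuousAt_arcAction (fun L hL => (hh₀ L hL).1.1.2) h1 (by linarith)
  · have := hh₀ (b - a) (by linarith)
    simp only [signedAction, hα]
    split_ifs
    · exact this.1.2.1 a b rfl
    · exact this.1.2.2 a b rfl

/-- Existence of oscillating periodic solutions with prescribed number of zeros. -/
theorem exists_periodic_solution (hf : TwoSidedForce g p m G G' M B K) :
    ∃ H : ℝ, 0 < H ∧ ∀ T, 0 < T → Function.Periodic p T → ∀ N n : ℕ, Even N → 0 < N →
      H * N ≤ n * T → ∃ (u v : ℝ → ℝ) (t : ℕ → ℝ), (∀ s, HasDerivAt u (v s) s) ∧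
        (∀ s, HasDerivAt v (p s - g (u s)) s) ∧ Function.Periodic u (n * T) ∧
        t N = t 0 + n * T ∧ (∀ i < N, t i < t (i + 1)) ∧ (∀ i ≤ N, u (t i) = 0) ∧
        ∀ i < N, ∀ s ∈ Ioo (t i) (t (i + 1)), u s ≠ 0 := by
  obtain ⟨α, lo, hi, h₀, ε, δ, hlo, hlohi, hδ, h1, hL, hL', hcosts⟩ := hf.exists_arcCosts
  have hA := hf.pos.gap_pos
  have hA' := hf.neg.gap_pos
  have hgb : h₀ + 1 + 1 ≤ IsMaxPartition.gapBound lo hi (h₀ + 1) δ := by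
    unfold IsMaxPartition.gapBound
    have e1 : 0 ≤ (h₀ + 1) / δ := by positivity
    have e2 : 0 ≤ 4 * (hi / lo) * ((3 * ((h₀ + 1) / δ)) ^ 3 + (h₀ + 1) ^ 3) := by
      have : 0 < hi := by linarith
      positivity
    linarith
  refine ⟨IsMaxPartition.gapBound lo hi (h₀ + 1) δ, by linarith, fun T hT hp N n hN hN0 hbig => ?_⟩
  have hc := hcosts T hp
  have hN0' : (0 : ℝ) ≤ N := Nat.cast_nonneg N
  obtain ⟨t, ht⟩ := hc.exists_isMaxPartition (τ := n * T) hT hN0 (by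
    have := mul_le_mul_of_nonneg_right hgb hN0'
    linarith)
  have hgap := ht.gap_lt hc hN hN0 rfl hbig
  have hgap₀ : ∀ i, h₀ < t (i + 1) - t i := fun i => by linarith [hgap i]
  choose w z hw using fun i => hf.exists_signedArc (hL _ (hgap₀ i).le) (hL' _ (hgap₀ i).le) i
  have hpτ : Function.Periodic p (n * T) := hp.nat_mul n
  have hmax := ht.isLocalMax hc hN hN0 rfl hgap
  have hlip : ∀ s, LipschitzWith K fun x => p s - g x := fun s => by
    simpa using (LipschitzWith.const (p s)).sub hf.pos.lip
  have hpc := hf.pos.cont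
  -- One global solution is launched with the data of arc `0`; matching velocities at the nodes
  -- force it to follow every arc in turn.
  obtain ⟨β, hβ0, hβ⟩ := exists_phase_curve (f := fun s x => p s - g x) (fun x => by fun_prop) hlip
    (fun s x => (abs_sub _ _).trans (add_le_add (hf.pos.bound_p s) (hf.pos.bound x))) (t 0)
    (0, z 0 (t 0))
  have hseg : ∀ i, β (t i) = (0, z i (t i)) →
      EqOn β (fun s => (w i s, z i s)) (Icc (t i) (t (i + 1))) := by
    intro i hi
    refine phase_curve_unique_Icc hlip (fun s _ => hβ s)
      (fun s hs => ((hw i).deriv_fst s).prodMk ((hw i).deriv_snd hs)) ?_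
    simp only [hi, (hw i).left]
  have hmono : ∀ i, t i < t (i + 1) := fun i => by linarith [hgap₀ i]
  have hstart : ∀ i, β (t i) = (0, z i (t i)) := by
    intro i
    induction i with
    | zero => exact hβ0
    | succ i ih =>
      rw [hseg i ih (right_mem_Icc.2 (hmono i).le)]
      have := hf.velocity_eq hL hL' h1 (hgap₀ i) (hgap₀ (i + 1)) (hw i) (hw (i + 1)) (hmax i)
      simp only [(hw i).right, this]
  have hclose : β (t 0 + n * T) = β (t 0) := by
    obtain ⟨N', rfl⟩ := Nat.exists_eq_succ_of_ne_zero hN0.ne'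
    have q0 : t (N' + 1) = t 0 + n * T := by simpa using ht.quasi 0
    have q1 : t (N' + 2) = t 1 + n * T := by
      have := ht.quasi 1
      rwa [show 1 + (N' + 1) = N' + 2 by ring] at this
    -- Arc `0` translated by one period serves as the arc following the last one; its sign is right
    -- because `N` is even.
    have hwt := (hw 0).translate hpτ (j := N' + 1) (by simpa using hN)
    rw [zero_add, ← q0, ← q1] at hwt
    have := hf.velocity_eq hL hL' h1 (hgap₀ N') (hgap₀ (N' + 1)) (hw N') hwt (hmax N')
    rw [← q0, hseg N' (hstart N') (right_mem_Icc.2 (hmono N').le), hβ0]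
    simp only [(hw N').right, this]
    rw [q0, add_sub_cancel_right]
  have hper : (fun s => β (s + n * T)) = β := by
    refine phase_curve_unique hlip (t₀ := t 0) (fun s => ?_) hβ hclose
    have := (hβ (s + n * T)).comp_add_const s (n * T)
    refine this.congr_deriv ?_
    simp only [phaseField, hpτ s]
  refine ⟨fun s => (β s).1, fun s => (β s).2, t, fun s => hasDerivAt_fst (hβ s),
    fun s => hasDerivAt_snd (hβ s), fun s => ?_, by simpa using ht.quasi 0, fun i _ => hmono i,
    fun i _ => by simp only [hstart i], fun i _ s hs => ?_⟩
  · exact congrArg Prod.fst (congrFun hper s)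
  · have := hseg i (hstart i) (Ioo_subset_Icc_self hs)
    simp only [this]
    exact (hw i).ne_zero (by linarith) (by linarith) hs

end TwoSidedForce

/-! ### From the standing assumptions to the two-sided force -/

namespace IsSaturatingForce

variable {g : ℝ → ℝ}

/-- The reflected force `s ↦ -g (-s)`. -/
lemma reflect (hg : IsSaturatingForce g) : IsSaturatingForce fun s => -g (-s) where
  map_zero := by simp [hg.map_zero]
  contDiff := (hg.contDiff.comp contDiff_neg).neg
  bounded := by
    obtain ⟨C, hC⟩ := hg.bounded
    exact ⟨C, fun s => by rw [abs_neg]; exact hC _⟩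
  strictMono := fun x y hxy => neg_lt_neg (hg.strictMono (neg_lt_neg hxy))
  strictConcaveOn_pos := by
    refine ⟨convex_Ioi 0, fun x hx y hy hxy a b ha hb hab => ?_⟩
    have := hg.strictConvexOn_neg.2 (x := -x) (by simpa using hx) (y := -y) (by simpa using hy)
      (by simpa using hxy) ha hb hab
    simp only [smul_eq_mul] at this ⊢
    rw [show -(a * x + b * y) = a * -x + b * -y by ring]
    linarith
  strictConvexOn_neg := by
    refine ⟨convex_Iio 0, fun x hx y hy hxy a b ha hb hab => ?_⟩
    have := hg.strictConcaveOn_pos.2 (x := -x) (by simpa using hx) (y := -y) (by simpa using hy)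
      (by simpa using hxy) ha hb hab
    simp only [smul_eq_mul] at this ⊢
    rw [show -(a * x + b * y) = a * -x + b * -y by ring]
    linarith

lemma deriv_nonneg (hg : IsSaturatingForce g) (x : ℝ) : 0 ≤ deriv g x :=
  hg.strictMono.monotone.deriv_nonneg

lemma differentiable (hg : IsSaturatingForce g) : Differentiable ℝ g :=
  hg.contDiff.differentiable (by norm_num)

/-- By concavity the derivative decreases on the positive axis, so its maximum over the compact
interval `[0, 1]` bounds it everywhere there. -/
lemma exists_deriv_le_of_nonneg (hg : IsSaturatingForce g) :
    ∃ C, ∀ x, 0 ≤ x → deriv g x ≤ C := by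
  have hanti := hg.strictConcaveOn_pos.concaveOn.antitoneOn_deriv fun x _ => hg.differentiable x
  have hcont : Continuous (deriv g) := hg.contDiff.continuous_deriv (by norm_num)
  obtain ⟨C, hC⟩ := (isCompact_Icc (a := (0 : ℝ)) (b := 1)).bddAbove_image hcont.continuousOn
  refine ⟨C, fun x hx => ?_⟩
  rcases le_total x 1 with h | h
  · exact hC (mem_image_of_mem _ ⟨hx, h⟩)
  · exact (hanti (mem_Ioi.2 one_pos) (mem_Ioi.2 (by linarith)) h).trans
      (hC (mem_image_of_mem _ ⟨zero_le_one, le_rfl⟩))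

lemma exists_lipschitzWith (hg : IsSaturatingForce g) : ∃ K : ℝ≥0, LipschitzWith K g := by
  obtain ⟨C₁, h₁⟩ := hg.exists_deriv_le_of_nonneg
  obtain ⟨C₂, h₂⟩ := hg.reflect.exists_deriv_le_of_nonneg
  have hd : ∀ x, deriv g x ≤ max C₁ C₂ := by
    intro x
    rcases le_total 0 x with h | h
    · exact (h₁ x h).trans (le_max_left _ _)
    · refine le_trans (le_of_eq ?_) ((h₂ (-x) (by linarith)).trans (le_max_right _ _))
      have h3 : HasDerivAt g (deriv g x) (- -x) := by
        rw [neg_neg]; exact (hg.differentiable x).hasDerivAt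
      have := (h3.comp (-x) (hasDerivAt_neg (-x))).neg
      simp only [mul_neg, mul_one, neg_neg] at this
      exact this.deriv.symm
  have hC : 0 ≤ max C₁ C₂ := (hg.deriv_nonneg 0).trans (hd 0)
  refine ⟨(max C₁ C₂).toNNReal, lipschitzWith_of_nnnorm_deriv_le hg.differentiable fun x => ?_⟩
  rw [← NNReal.coe_le_coe, Real.coe_toNNReal _ hC, coe_nnnorm, Real.norm_eq_abs,
    abs_of_nonneg (hg.deriv_nonneg x)]
  exact hd x

end IsSaturatingForce

lemma exists_bound_of_periodic {f : ℝ → ℝ} {T : ℝ} (hT : T ≠ 0) (hf : Continuous f)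
    (hp : Function.Periodic f T) : ∃ M, ∀ t, |f t| ≤ M := by
  obtain ⟨M, hM⟩ := (hp.isBounded_of_continuous hT hf).exists_norm_le
  exact ⟨M, fun t => hM _ (mem_range_self t)⟩

/-- Subtracting the mean makes the primitive of `p` periodic, hence bounded. -/
lemma exists_mean_bound {p : ℝ → ℝ} {T : ℝ} (hT : 0 < T) (hp : Continuous p)
    (hper : Function.Periodic p T) :
    ∃ B, ∀ s t, |(∫ r in s..t, p r) - ((1 / T) * ∫ r in (0 : ℝ)..T, p r) * (t - s)| ≤ B := by
  set m := (1 / T) * ∫ r in (0 : ℝ)..T, p r with hm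
  have hi : ∀ a b, IntervalIntegrable p volume a b := hp.intervalIntegrable
  set F : ℝ → ℝ := fun s => (∫ r in (0 : ℝ)..s, p r) - m * s with hF
  have hFc : Continuous F := by
    have := intervalIntegral.continuous_primitive hi 0
    fun_prop
  have hFp : Function.Periodic F T := by
    intro s
    have h1 := hper.intervalIntegral_add_eq s 0
    have h2 := intervalIntegral.integral_add_adjacent_intervals (hi 0 s) (hi s (s + T))
    rw [zero_add] at h1
    have h3 : m * T = ∫ r in (0 : ℝ)..T, p r := by rw [hm]; field_simp
    simp only [hF]
    rw [← h2, h1, mul_add, h3]; ring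
  obtain ⟨C, hC⟩ := exists_bound_of_periodic hT.ne' hFc hFp
  refine ⟨C + C, fun s t => ?_⟩
  have h1 := intervalIntegral.integral_interval_sub_left (hi 0 t) (hi 0 s)
  have : (∫ r in s..t, p r) - m * (t - s) = F t - F s := by
    simp only [hF]; rw [← h1]; ring
  rw [this]
  exact (abs_sub _ _).trans (add_le_add (hC _) (hC _))

theorem exists_twoSidedForce {g p : ℝ → ℝ} {gminus gplus T : ℝ} (hg : IsSaturatingForce g)
    (hgminus : Tendsto g atBot (𝓝 gminus)) (hgplus : Tendsto g atTop (𝓝 gplus))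
    (hp : Continuous p) (hT : 0 < T) (hper : Function.Periodic p T)
    (h1 : gminus < (1 / T) * ∫ t in (0 : ℝ)..T, p t)
    (h2 : (1 / T) * ∫ t in (0 : ℝ)..T, p t < gplus) :
    ∃ M B K, TwoSidedForce g p ((1 / T) * ∫ t in (0 : ℝ)..T, p t) gplus (-gminus) M B K := by
  obtain ⟨K, hK⟩ := hg.exists_lipschitzWith
  obtain ⟨M₁, hM₁⟩ := hg.bounded
  obtain ⟨M₂, hM₂⟩ := exists_bound_of_periodic hT.ne' hp hper
  obtain ⟨B, hB⟩ := exists_mean_bound hT hp hper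
  refine ⟨max M₁ M₂, B, K, ?_, ?_⟩
  · exact
      { map_zero := hg.map_zero
        lip := hK
        bound := fun s => (hM₁ s).trans (le_max_left _ _)
        mono := hg.strictMono.monotone
        lim := hgplus
        concave := hg.strictConcaveOn_pos.concaveOn
        cont := hp
        bound_p := fun t => (hM₂ t).trans (le_max_right _ _)
        mean := hB
        gap := h2 }
  · exact
      { map_zero := hg.reflect.map_zero
        lip := LipschitzWith.of_dist_le_mul fun x y => by
          rw [dist_neg_neg, ← dist_neg_neg x y]; exact hK.dist_le_mul _ _
        bound := fun s => by rw [abs_neg]; exact (hM₁ _).trans (le_max_left _ _)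
        mono := hg.reflect.strictMono.monotone
        lim := (hgminus.comp tendsto_neg_atTop_atBot).neg
        concave := hg.reflect.strictConcaveOn_pos.concaveOn
        cont := hp.neg
        bound_p := fun t => by rw [abs_neg]; exact (hM₂ t).trans (le_max_right _ _)
        mean := fun s t => by
          rw [intervalIntegral.integral_neg, ← abs_neg]
          refine le_trans (le_of_eq ?_) (hB s t)
          congr 1; ring
        gap := neg_lt_neg h1 }

/-! ### Counting zeros and minimal periods -/

/-- The zeros of `u` in `[a, a + τ)`. -/
def zerosIco (u : ℝ → ℝ) (a τ : ℝ) : Set ℝ := {t | t ∈ Ico a (a + τ) ∧ u t = 0}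

lemma zerosIco_encard_le {u : ℝ → ℝ} {τ : ℝ} (hτ : 0 < τ) (hu : Function.Periodic u τ) (a b : ℝ) :
    (zerosIco u a τ).encard ≤ (zerosIco u b τ).encard := by
  refine encard_le_encard_of_injOn (f := toIcoMod hτ b) (fun x hx => ?_) fun x hx y hy hxy => ?_
  · refine ⟨toIcoMod_mem_Ico hτ b x, ?_⟩
    rw [toIcoMod, hu.sub_zsmul_eq]; exact hx.2
  · obtain ⟨n, hn⟩ := (toIcoMod_eq_toIcoMod hτ).1 hxy
    rw [zsmul_eq_mul] at hn
    have h1 : (n : ℝ) < 1 := by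
      by_contra! h
      have := mul_le_mul_of_nonneg_right h hτ.le
      linarith [hx.1.1, hy.1.2]
    have h2 : (-1 : ℝ) < n := by
      by_contra! h
      have := mul_le_mul_of_nonneg_right h hτ.le
      linarith [hx.1.2, hy.1.1]
    have h3 : n = 0 := by
      have h1' : n < 1 := by exact_mod_cast h1
      have h2' : -1 < n := by exact_mod_cast h2
      omega
    rw [h3] at hn
    push_cast at hn
    linarith

lemma zerosIco_encard_eq {u : ℝ → ℝ} {τ : ℝ} (hτ : 0 < τ) (hu : Function.Periodic u τ) (a b : ℝ) :
    (zerosIco u a τ).encard = (zerosIco u b τ).encard :=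
  le_antisymm (zerosIco_encard_le hτ hu a b) (zerosIco_encard_le hτ hu b a)

lemma zerosIco_encard_mul {u : ℝ → ℝ} {σ : ℝ} (hσ : 0 < σ) (hu : Function.Periodic u σ) (a : ℝ)
    (e : ℕ) : (zerosIco u a (e * σ)).encard = e * (zerosIco u a σ).encard := by
  induction e with
  | zero => simp [zerosIco]
  | succ e ih =>
    have he : 0 ≤ e * σ := by positivity
    have h1 : zerosIco u a ((e + 1 : ℕ) * σ) =
        zerosIco u a (e * σ) ∪ zerosIco u (a + e * σ) σ := by
      ext t
      simp only [zerosIco, mem_ofPred_eq, mem_union, mem_Ico]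
      push_cast
      constructor
      · rintro ⟨⟨h1, h2⟩, h3⟩
        rcases lt_or_ge t (a + e * σ) with h | h
        · exact Or.inl ⟨⟨h1, h⟩, h3⟩
        · exact Or.inr ⟨⟨h, by linarith⟩, h3⟩
      · rintro (⟨⟨h1, h2⟩, h3⟩ | ⟨⟨h1, h2⟩, h3⟩)
        · exact ⟨⟨h1, by linarith⟩, h3⟩
        · exact ⟨⟨by linarith, by linarith⟩, h3⟩
    have h2 : Disjoint (zerosIco u a (e * σ)) (zerosIco u (a + e * σ) σ) :=
      disjoint_left.2 fun t ht ht' => absurd ht.1.2 (not_lt.2 ht'.1.1)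
    rw [h1, encard_union_eq h2, ih, zerosIco_encard_eq hσ hu (a + e * σ) a]
    push_cast
    ring

lemma zerosIco_encard_of_partition {u : ℝ → ℝ} {t : ℕ → ℝ} {N : ℕ} {τ : ℝ} (hN : t N = t 0 + τ)
    (ht : ∀ i < N, t i < t (i + 1)) (hz : ∀ i ≤ N, u (t i) = 0)
    (hnz : ∀ i < N, ∀ s ∈ Ioo (t i) (t (i + 1)), u s ≠ 0) :
    (zerosIco u (t 0) τ).encard = N := by
  have hmono : ∀ j ≤ N, ∀ i < j, t i < t j := by
    intro j
    induction j with
    | zero => intro _ i hi; omega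
    | succ j ih =>
      intro hj i hi
      rcases Nat.lt_succ_iff_lt_or_eq.1 hi with h | rfl
      · exact (ih (by omega) i h).trans (ht j (by omega))
      · exact ht _ (by omega)
  have hinj : InjOn t {i | i < N} := by
    intro i hi j hj hij
    by_contra hne
    rcases Nat.lt_or_gt_of_ne hne with h | h
    · exact (hmono j (le_of_lt hj) i h).ne hij
    · exact (hmono i (le_of_lt hi) j h).ne hij.symm
  have himg : zerosIco u (t 0) τ = t '' {i | i < N} := by
    ext s
    constructor
    · rintro ⟨⟨h1, h2⟩, h3⟩
      rw [← hN] at h2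
      have hex : ∃ i, s < t i := ⟨N, h2⟩
      classical
      set j := Nat.find hex with hj
      have hjs : s < t j := Nat.find_spec hex
      have hjN : j ≤ N := Nat.find_min' hex h2
      have hj0 : j ≠ 0 := fun h => by rw [h] at hjs; linarith
      obtain ⟨i, hi⟩ := Nat.exists_eq_succ_of_ne_zero hj0
      have his : t i ≤ s := not_lt.1 (Nat.find_min hex (by omega : i < j))
      rw [hi] at hjs
      refine ⟨i, by simp only [mem_ofPred_eq]; omega, ?_⟩
      by_contra hne
      exact hnz i (by omega) s ⟨lt_of_le_of_ne his hne, hjs⟩ h3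
    · rintro ⟨i, hi, rfl⟩
      refine ⟨⟨?_, ?_⟩, hz i (le_of_lt hi)⟩
      · rcases Nat.eq_zero_or_pos i with rfl | h
        · exact le_rfl
        · exact (hmono i (le_of_lt hi) 0 h).le
      · rw [← hN]; exact hmono N le_rfl i hi
  rw [himg, hinj.encard_image, Nat.encard_range]

lemma IsMinimalPeriod.eq {f : ℝ → ℝ} {σ τ : ℝ} (h : IsMinimalPeriod f σ)
    (h' : IsMinimalPeriod f τ) : σ = τ :=
  le_antisymm (h.2.2 τ h'.1 h'.2.1) (h'.2.2 σ h.1 h.2.1)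

/-- The remainder of `σ` modulo `T` would be a period smaller than `T` unless it is zero. -/
lemma IsMinimalPeriod.exists_nat_mul {f : ℝ → ℝ} {T σ : ℝ} (h : IsMinimalPeriod f T) (hσ : 0 < σ)
    (hf : Function.Periodic f σ) : ∃ j : ℕ, 0 < j ∧ σ = j * T := by
  set r := toIcoMod h.1 0 σ with hr
  have hmem := toIcoMod_mem_Ico h.1 0 σ
  have hrp : Function.Periodic f r := by
    rw [hr, toIcoMod]
    exact hf.sub_period (h.2.1.zsmul _)
  have hr0 : r = 0 := by
    rcases hmem.1.eq_or_lt with h0 | h0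
    · exact h0.symm
    · have := h.2.2 r h0 hrp
      have h2 := hmem.2
      rw [zero_add] at h2
      linarith
  set z := toIcoDiv h.1 0 σ with hz
  have hσz : σ = z * T := by
    have : σ - z • T = 0 := hr0
    rw [zsmul_eq_mul] at this
    linarith
  have hz0 : 0 < z := by
    rw [hσz] at hσ
    exact_mod_cast pos_of_mul_pos_left hσ h.1.le
  lift z to ℕ using hz0.le with j hj
  exact ⟨j, by exact_mod_cast hz0, by exact_mod_cast hσz⟩

/-- Continuity makes the set of periods `≥ ρ` closed, so its infimum is a period; the lower bound
`ρ` keeps the infimum positive. -/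
lemma exists_isMinimalPeriod {f : ℝ → ℝ} (hf : Continuous f) {ρ τ : ℝ} (hρ : 0 < ρ) (hτ : 0 < τ)
    (hfτ : Function.Periodic f τ) (hlow : ∀ σ, 0 < σ → Function.Periodic f σ → ρ ≤ σ) :
    ∃ σ, ρ ≤ σ ∧ IsMinimalPeriod f σ := by
  set P : Set ℝ := {σ | ρ ≤ σ ∧ Function.Periodic f σ} with hP
  have hclosed : IsClosed P := by
    have : P = {σ | ρ ≤ σ} ∩ ⋂ x, {σ | f (x + σ) = f x} := by
      ext σ; simp [hP, Function.Periodic]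
    rw [this]
    exact (isClosed_le continuous_const continuous_id).inter
      (isClosed_iInter fun x => isClosed_eq (by fun_prop) continuous_const)
  have hbdd : BddBelow P := ⟨ρ, fun σ hσ => hσ.1⟩
  have hmem := hclosed.csInf_mem ⟨τ, hlow τ hτ hfτ, hfτ⟩ hbdd
  exact ⟨sInf P, hmem.1, hρ.trans_le hmem.1, hmem.2,
    fun σ hσ hσp => csInf_le hbdd ⟨hlow σ hσ hσp, hσp⟩⟩

section Solution

variable {g p u v : ℝ → ℝ}

lemma isSolution_of_hasDerivAt (hg : Continuous g) (hp : Continuous p)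
    (hu : ∀ s, HasDerivAt u (v s) s) (hv : ∀ s, HasDerivAt v (p s - g (u s)) s) :
    IsSolution g p u := by
  have hdu : deriv u = v := funext fun s => (hu s).deriv
  have hdv : deriv v = fun s => p s - g (u s) := funext fun s => (hv s).deriv
  have hud : Differentiable ℝ u := fun s => (hu s).differentiableAt
  have hvd : Differentiable ℝ v := fun s => (hv s).differentiableAt
  refine ⟨?_, fun t => by rw [hdu, hdv]; ring⟩
  have huc := hud.continuous
  rw [show (2 : WithTop ℕ∞) = 1 + 1 by norm_num, contDiff_succ_iff_deriv, hdu,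
    contDiff_one_iff_deriv, hdv]
  exact ⟨hud, by simp, hvd, by fun_prop⟩

/-- The equation expresses `p` through `u` and its second derivative, both of which inherit the
period. -/
lemma periodic_forcing {σ : ℝ} (hu : ∀ s, HasDerivAt u (v s) s)
    (hv : ∀ s, HasDerivAt v (p s - g (u s)) s) (hσ : Function.Periodic u σ) :
    Function.Periodic p σ := by
  have hvσ : Function.Periodic v σ := fun s => by
    have h1 := (hu (s + σ)).comp_add_const s σ
    rw [show (fun x => u (x + σ)) = u from funext hσ] at h1
    exact h1.unique (hu s)
  intro s
  have h1 := (hv (s + σ)).comp_add_const s σ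
  rw [show (fun x => v (x + σ)) = v from funext hvσ] at h1
  have h2 := h1.unique (hv s)
  rw [hσ s] at h2
  linarith

lemma isMinimalPeriod_of_coprime {T : ℝ} {n N : ℕ} (hu : ∀ s, HasDerivAt u (v s) s)
    (hv : ∀ s, HasDerivAt v (p s - g (u s)) s) (hn : 0 < n)
    (huper : Function.Periodic u (n * T)) (hcount : ∀ a, (zerosIco u a (n * T)).encard = N)
    (hpT : IsMinimalPeriod p T) (hcop : Nat.Coprime n N) : IsMinimalPeriod u (n * T) := by
  have hT := hpT.1
  have hn' : (0 : ℝ) < n := by exact_mod_cast hn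
  refine ⟨by positivity, huper, fun σ hσ hσu => ?_⟩
  obtain ⟨j, hj, rfl⟩ := hpT.exists_nat_mul hσ (periodic_forcing hu hv hσu)
  set d := Nat.gcd j n with hd
  have hd0 : 0 < d := Nat.gcd_pos_of_pos_left n hj
  have hdu : Function.Periodic u (d * T) := by
    -- Bézout: integer combinations of the periods `j T` and `n T` are periods.
    have h1 := (hσu.int_mul (Nat.gcdA j n)).add_period (huper.int_mul (Nat.gcdB j n))
    have h2 := congrArg (fun z : ℤ => (z : ℝ)) (Nat.gcd_eq_gcd_ab j n)
    push_cast at h2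
    rw [hd, h2]
    convert! h1 using 1
    ring
  obtain ⟨e, he⟩ : d ∣ n := Nat.gcd_dvd_right j n
  have he0 : e ≠ 0 := by rintro rfl; omega
  have hc := zerosIco_encard_mul (mul_pos (by exact_mod_cast hd0 : (0 : ℝ) < d) hT) hdu 0 e
  rw [show (e : ℝ) * (d * T) = n * T by rw [he]; push_cast; ring, hcount] at hc
  -- An interval of length `n T` consists of `e` periods of length `d T`, each with the same number
  -- of zeros; this number is finite since `N` is.
  have hdvd : e ∣ N := by
    cases hz : (zerosIco u 0 (d * T)).encard with
    | top =>
      rw [hz, ENat.mul_top (by exact_mod_cast he0)] at hc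
      exact absurd hc (ENat.natCast_ne_top N)
    | coe z =>
      rw [hz] at hc
      exact ⟨z, by exact_mod_cast hc⟩
  have he1 : e = 1 := Nat.eq_one_of_dvd_coprimes hcop ⟨d, by rw [he]; ring⟩ hdvd
  have hdn : d = n := by rw [he, he1, mul_one]
  have hnj : n ≤ j := Nat.le_of_dvd hj (hdn ▸ Nat.gcd_dvd_left j n)
  exact mul_le_mul_of_nonneg_right (by exact_mod_cast hnj) hT.le

/-- A function with two zeros per period `τ` has no period shorter than `τ / 3`. -/
lemma le_period_of_two_zeros {τ t₀ σ : ℝ} (h0 : u t₀ = 0)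
    (hcount : (zerosIco u t₀ τ).encard = 2) (hσ : 0 < σ) (hu : Function.Periodic u σ) :
    τ / 3 ≤ σ := by
  by_contra! hlt
  have h1 := zerosIco_encard_mul hσ hu t₀ 3
  have h2 : 1 ≤ (zerosIco u t₀ σ).encard :=
    one_le_encard_iff_nonempty.2 ⟨t₀, ⟨le_rfl, by linarith⟩, h0⟩
  have h3 : (zerosIco u t₀ ((3 : ℕ) * σ)).encard ≤ (zerosIco u t₀ τ).encard :=
    encard_le_encard fun t ht => ⟨⟨ht.1.1, by have := ht.1.2; push_cast at this; linarith⟩, ht.2⟩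
  rw [h1, hcount] at h3
  have h4 : ((3 : ℕ) : ℕ∞) * 1 ≤ 2 := (mul_le_mul_right h2 _).trans h3
  norm_num at h4

end Solution

theorem theorem7 (g p : ℝ → ℝ) (gminus gplus : ℝ)
    (hg : IsSaturatingForce g)
    (hgminus : Filter.Tendsto g Filter.atBot (nhds gminus))
    (hgplus : Filter.Tendsto g Filter.atTop (nhds gplus))
    (hp : Continuous p) :
    ∃ H : ℝ, 0 < H ∧
      ∀ T : ℝ, 0 < T → Function.Periodic p T →
        gminus < (1 / T) * ∫ t in (0 : ℝ)..T, p t →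
        (1 / T) * ∫ t in (0 : ℝ)..T, p t < gplus →
        (∀ k n : ℕ, Odd k → H * ((k : ℝ) + 1) ≤ (n : ℝ) * T →
          ∃ u : ℝ → ℝ, IsSolution g p u ∧ Function.Periodic u ((n : ℝ) * T) ∧
            (∃ t₀ : ℝ, u t₀ = 0 ∧
              {t : ℝ | t ∈ Set.Ioo t₀ (t₀ + (n : ℝ) * T) ∧ u t = 0}.encard = (k : ℕ∞)) ∧
            (∀ a : ℝ,
              {t : ℝ | t ∈ Set.Ico a (a + (n : ℝ) * T) ∧ u t = 0}.encard = (k : ℕ∞) + 1) ∧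
            (IsMinimalPeriod p T → Nat.Coprime n (k + 1) →
              IsMinimalPeriod u ((n : ℝ) * T))) ∧
        (∃ (u : ℕ → ℝ → ℝ) (N : ℕ → ℕ) (τ : ℕ → ℝ), StrictMono N ∧
          Filter.Tendsto τ Filter.atTop Filter.atTop ∧
          ∀ j : ℕ, IsSolution g p (u j) ∧ Function.Periodic (u j) ((N j : ℝ) * T) ∧
            IsMinimalPeriod (u j) (τ j) ∧
            (IsMinimalPeriod p T → τ j = (N j : ℝ) * T)) := by
  -- `H` must be fixed before `T`. Any admissible period `T₀` supplies the mean and all constants,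
  -- and these serve every other period of `p`; if there is none, the assertion is vacuous.
  by_cases hex : ∃ T₀ : ℝ, 0 < T₀ ∧ Function.Periodic p T₀ ∧
      gminus < (1 / T₀) * ∫ t in (0 : ℝ)..T₀, p t ∧ (1 / T₀) * ∫ t in (0 : ℝ)..T₀, p t < gplus
  swap
  · exact ⟨1, one_pos, fun T hT hper h1 h2 => absurd ⟨T, hT, hper, h1, h2⟩ hex⟩
  obtain ⟨T₀, hT₀, hper₀, hm₁, hm₂⟩ := hex
  obtain ⟨M, B, K, hf⟩ := exists_twoSidedForce hg hgminus hgplus hp hT₀ hper₀ hm₁ hm₂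
  obtain ⟨H, hH, hsol⟩ := hf.exists_periodic_solution
  refine ⟨H, hH, fun T hT hper _ _ => ?_⟩
  have hgc : Continuous g := hg.contDiff.continuous
  have main : ∀ k n : ℕ, Odd k → H * ((k : ℝ) + 1) ≤ (n : ℝ) * T →
      ∃ u : ℝ → ℝ, IsSolution g p u ∧ Function.Periodic u ((n : ℝ) * T) ∧
        (∃ t₀ : ℝ, u t₀ = 0 ∧
          {t : ℝ | t ∈ Set.Ioo t₀ (t₀ + (n : ℝ) * T) ∧ u t = 0}.encard = (k : ℕ∞)) ∧
        (∀ a : ℝ,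
          {t : ℝ | t ∈ Set.Ico a (a + (n : ℝ) * T) ∧ u t = 0}.encard = (k : ℕ∞) + 1) ∧
        (IsMinimalPeriod p T → Nat.Coprime n (k + 1) → IsMinimalPeriod u ((n : ℝ) * T)) := by
    intro k n hk hkn
    have hnT : 0 < n * T := lt_of_lt_of_le (by positivity) hkn
    have hn : 0 < n := by
      rcases Nat.eq_zero_or_pos n with rfl | h
      · simp at hnT
      · exact h
    obtain ⟨u, v, t, hu, hv, huper, htN, htmono, hz, hnz⟩ :=
      hsol T hT hper (k + 1) n hk.add_one (Nat.succ_pos k) (by push_cast; exact hkn)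
    have hcount : ∀ a, (zerosIco u a (n * T)).encard = (k + 1 : ℕ) := fun a => by
      rw [zerosIco_encard_eq hnT huper a (t 0)]
      exact zerosIco_encard_of_partition htN htmono hz hnz
    have hz0 := hz 0 (Nat.zero_le _)
    refine ⟨u, isSolution_of_hasDerivAt hgc hp hu hv, huper, ⟨t 0, hz0, ?_⟩,
      fun a => by have := hcount a; push_cast at this; exact this,
      fun hmin hcop => isMinimalPeriod_of_coprime hu hv hn huper hcount hmin hcop⟩
    have hset : {s : ℝ | s ∈ Set.Ioo (t 0) (t 0 + (n : ℝ) * T) ∧ u s = 0} =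
        zerosIco u (t 0) (n * T) \ {t 0} := by
      ext s
      simp only [zerosIco, mem_ofPred_eq, mem_Ioo, mem_Ico, Set.mem_sdiff, mem_singleton_iff]
      constructor
      · rintro ⟨⟨h1, h2⟩, h3⟩
        exact ⟨⟨⟨h1.le, h2⟩, h3⟩, h1.ne'⟩
      · rintro ⟨⟨⟨h1, h2⟩, h3⟩, h4⟩
        exact ⟨⟨lt_of_le_of_ne h1 (Ne.symm h4), h2⟩, h3⟩
    have hmem : t 0 ∈ zerosIco u (t 0) (n * T) := ⟨⟨le_rfl, by linarith⟩, hz0⟩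
    have h1 := encard_sdiff_singleton_add_one hmem
    rw [← hset, hcount] at h1
    push_cast at h1
    exact (ENat.addLECancellable_of_ne_top ENat.one_ne_top).inj_left.1 h1
  refine ⟨main, ?_⟩
  -- With `k = 1` the condition reads `n T ≥ 2 H`. The choice `n = 2 (j + n₀) + 1` satisfies it and
  -- is odd, hence coprime to `k + 1 = 2`.
  obtain ⟨n₀, hn₀⟩ := exists_nat_gt (2 * H / T)
  rw [div_lt_iff₀ hT] at hn₀
  have hbig : ∀ j : ℕ, H * (((1 : ℕ) : ℝ) + 1) ≤ ((2 * (j + n₀) + 1 : ℕ) : ℝ) * T := by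
    intro j
    have h1 : (n₀ : ℝ) ≤ ((2 * (j + n₀) + 1 : ℕ) : ℝ) := by exact_mod_cast (by omega)
    have h2 := mul_le_mul_of_nonneg_right h1 hT.le
    push_cast at h2 ⊢
    linarith
  choose u hu1 hu2 hu3 hu4 hu5 using fun j => main 1 (2 * (j + n₀) + 1) odd_one (hbig j)
  have hpos : ∀ j : ℕ, 0 < ((2 * (j + n₀) + 1 : ℕ) : ℝ) * T := fun j => by positivity
  choose τ hτ1 hτ2 using fun j => exists_isMinimalPeriod (hu1 j).1.continuous
    (div_pos (hpos j) three_pos) (hpos j) (hu2 j) (fun σ hσ hσp => by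
      obtain ⟨t₀, ht₀, -⟩ := hu3 j
      refine le_period_of_two_zeros ht₀ ?_ hσ hσp
      have := hu4 j t₀
      rw [show ((1 : ℕ) : ℕ∞) + 1 = 2 by norm_num] at this
      exact this)
  refine ⟨u, fun j => 2 * (j + n₀) + 1, τ, fun i j hij => by dsimp only; omega, ?_, fun j =>
    ⟨hu1 j, hu2 j, hτ2 j, fun hmin => (hτ2 j).eq (hu5 j hmin ?_)⟩⟩
  · have h1 : Tendsto (fun j : ℕ => (T / 3) * (j : ℝ)) atTop atTop :=
      tendsto_natCast_atTop_atTop.const_mul_atTop (by positivity)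
    refine tendsto_atTop_mono (fun j => le_trans ?_ (hτ1 j)) h1
    have h2 : (j : ℝ) ≤ ((2 * (j + n₀) + 1 : ℕ) : ℝ) := by exact_mod_cast (by omega)
    have h3 := mul_le_mul_of_nonneg_right h2 hT.le
    linarith
  · rw [Nat.coprime_comm]
    exact (Nat.coprime_two_left).2 ⟨j + n₀, rfl⟩
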